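/- Let $X=\widehat{\mathbb{Q}^2}$ be the (compact) Pontryagin dual of the discrete group $\mathbb{Q}^2$, equipped with its Haar probability measure, and let $SL_2(\mathbb{Q})$ act on $X$ by $(g\chi)(v)=\chi(g^{-1}v)$ for $g\in SL_2(\mathbb{Q})$, $\chi\in X$, $v\in\mathbb{Q}^2$. Let $Y$ be the quotient of $X$ by the relation $\phi\sim\phi'$, where $\phi'(v)=\phi(-v)$ for all $v\in\mathbb{Q}^2$, with the quotient $\sigma$-algebra and the image $\mu$ of the Haar probability measure. The action of $SL_2(\mathbb{Q})$ descends to $Y$, and since $-\mathrm{id}$ acts trivially on $Y$, it induces a measure preserving action of $\bar G=PSL_2(\mathbb{Q})$ on $(Y,\mu)$. Let $L^\infty(Y)\rtimes\bar G$ be the crossed product von Neumann algebra, that is, the von Neumann algebra on $L^2(Y,\mu)\otimes\ell^2(\bar G)$ generated by the operators $f\otimes 1$ ($f\in L^\infty(Y,\mu)$ acting by multiplication) and the unitaries $u_g=\sigma_g\otimes\lambda_g$ ($g\in\bar G$), where $(\sigma_g\xi)(y)=\xi(g^{-1}y)$ and $\lambda$ is the left regular representation; let $L(\bar G)\subset L^\infty(Y)\rtimes\bar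 G$ be the von Neumann subalgebra generated by $\{u_g: g\in\bar G\}$. Then $L(\bar G)$ is a maximal von Neumann subalgebra of $L^\infty(Y)\rtimes\bar G$: one has $L(\bar G)\subsetneq L^\infty(Y)\rtimes\bar G$, and every von Neumann algebra $P$ with $L(\bar G)\subseteq P\subseteq L^\infty(Y)\rtimes\bar G$ satisfies $P=L(\bar G)$ or $P=L^\infty(Y)\rtimes\bar G$. -/

import Mathlib

open MeasureTheory
open scoped ENNReal MatrixGroups

noncomputable section

/-! ### Von Neumann algebras generated by sets of operators -/

/-- The von Neumann algebra on the Hilbert space `H` generated by a set `S` of bounded operators: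
the bicommutant of `S ∪ star S`. -/
def vonNeumannClosure {H : Type*} [NormedAddCommGroup H] [InnerProductSpace ℂ H] [CompleteSpace H]
    (S : Set (H →L[ℂ] H)) : VonNeumannAlgebra H where
  toStarSubalgebra :=
    StarSubalgebra.centralizer ℂ (StarSubalgebra.centralizer ℂ S : Set (H →L[ℂ] H))
  centralizer_centralizer' := by
    change Set.centralizer (Set.centralizer
      (StarSubalgebra.centralizer ℂ (StarSubalgebra.centralizer ℂ S : Set (H →L[ℂ] H)) :
        Set (H →L[ℂ] H))) =
      (StarSubalgebra.centralizer ℂ (StarSubalgebra.centralizer ℂ S : Set (H →L[ℂ] H)) :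
        Set (H →L[ℂ] H))
    rw [StarSubalgebra.coe_centralizer_centralizer, Set.centralizer_centralizer_centralizer]

/-- `vonNeumannClosure S` is the smallest von Neumann algebra containing `S`. -/
theorem vonNeumannClosure_le_iff {H : Type*} [NormedAddCommGroup H] [InnerProductSpace ℂ H]
    [CompleteSpace H] (S : Set (H →L[ℂ] H)) (N : VonNeumannAlgebra H) :
    vonNeumannClosure S ≤ N ↔ S ⊆ (N : Set (H →L[ℂ] H)) := by
  have hc : ((vonNeumannClosure S : VonNeumannAlgebra H) : Set (H →L[ℂ] H)) =
      Set.centralizer (Set.centralizer (S ∪ star S)) :=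
    StarSubalgebra.coe_centralizer_centralizer ℂ S
  rw [← SetLike.coe_subset_coe, hc]
  constructor
  · intro h
    exact (Set.subset_union_left.trans Set.subset_centralizer_centralizer).trans h
  · intro h
    have h2 : S ∪ star S ⊆ (N : Set (H →L[ℂ] H)) := by
      apply Set.union_subset h
      intro x hx
      have := star_mem (h hx)
      simpa using this
    rw [← N.centralizer_centralizer]
    exact Set.centralizer_subset (Set.centralizer_subset h2)

/-! ### The crossed product of a measure preserving action -/

section CrossedProduct

/-- The Hilbert space `ℓ²(Γ, E)`. -/
abbrev EllTwo (Γ : Type*) (E : Type*) [NormedAddCommGroup E] : Type _ :=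
  lp (fun _ : Γ => E) 2

/-- The bounded operator `ξ ↦ (g ↦ T (ξ (s⁻¹ g)))` on `ℓ²(Γ, E)`, that is `T ⊗ λ_s`. -/
def tensorShift {Γ : Type*} [Group Γ] {E : Type*} [NormedAddCommGroup E] [NormedSpace ℂ E]
    (T : E →L[ℂ] E) (s : Γ) : EllTwo Γ E →L[ℂ] EllTwo Γ E :=
  have hsum : ∀ ξ : EllTwo Γ E, Summable fun g : Γ => ‖ξ (s⁻¹ * g)‖ ^ (2 : ℝ) := fun ξ => by
    have h := (lp.memℓp ξ).summable (by norm_num)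
    rw [show (2 : ℝ≥0∞).toReal = 2 by norm_num] at h
    exact (Equiv.mulLeft s⁻¹).summable_iff.mpr h
  have hle : ∀ (ξ : EllTwo Γ E) (g : Γ),
      ‖T (ξ (s⁻¹ * g))‖ ^ (2 : ℝ) ≤ ‖T‖ ^ (2 : ℝ) * ‖ξ (s⁻¹ * g)‖ ^ (2 : ℝ) := fun ξ g => by
    rw [← Real.mul_rpow (norm_nonneg _) (norm_nonneg _)]
    exact Real.rpow_le_rpow (norm_nonneg _) (T.le_opNorm _) (by norm_num)
  have hmem : ∀ ξ : EllTwo Γ E, Memℓp (fun g : Γ => T (ξ (s⁻¹ * g))) 2 := fun ξ => by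
    refine memℓp_gen ?_
    simpa using Summable.of_nonneg_of_le (fun g => by positivity) (hle ξ) ((hsum ξ).mul_left _)
  LinearMap.mkContinuous
    { toFun := fun ξ => ⟨fun g => T (ξ (s⁻¹ * g)), hmem ξ⟩
      map_add' := fun ξ η => by
        ext1; funext g
        exact T.map_add _ _
      map_smul' := fun c ξ => by
        ext1; funext g
        exact T.map_smul _ _ }
    ‖T‖ fun ξ => by
      refine lp.norm_le_of_tsum_le (by norm_num) (by positivity) ?_
      have h1 : ‖ξ‖ ^ (2 : ℝ) = ∑' g : Γ, ‖ξ (s⁻¹ * g)‖ ^ (2 : ℝ) := by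
        have h := lp.norm_rpow_eq_tsum (p := 2) (by norm_num) ξ
        rw [show (2 : ℝ≥0∞).toReal = 2 by norm_num] at h
        rw [h]
        exact ((Equiv.mulLeft s⁻¹).tsum_eq fun g => ‖ξ g‖ ^ (2 : ℝ)).symm
      rw [show (2 : ℝ≥0∞).toReal = 2 by norm_num,
        Real.mul_rpow (norm_nonneg _) (norm_nonneg _), h1, ← tsum_mul_left]
      exact Summable.tsum_le_tsum (hle ξ)
        (Summable.of_nonneg_of_le (fun g => by positivity) (hle ξ) ((hsum ξ).mul_left _))
        ((hsum ξ).mul_left _)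

@[simp]
theorem tensorShift_apply {Γ : Type*} [Group Γ] {E : Type*} [NormedAddCommGroup E]
    [NormedSpace ℂ E] (T : E →L[ℂ] E) (s : Γ) (ξ : EllTwo Γ E) (g : Γ) :
    tensorShift T s ξ g = T (ξ (s⁻¹ * g)) := rfl

variable {Γ Y : Type*} [Group Γ] [MeasurableSpace Y] [MulAction Γ Y] [MeasurableConstSMul Γ Y]
  (μ : Measure Y) [SMulInvariantMeasure Γ Y μ]

/-- The Koopman operator `σ_s` on `L²(Y, μ)`: `(σ_s f)(y) = f (s⁻¹ y)`. -/
def koopman (s : Γ) : Lp ℂ 2 μ →L[ℂ] Lp ℂ 2 μ :=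
  (Lp.compMeasurePreservingₗᵢ ℂ (fun y : Y => s⁻¹ • y)
    (measurePreserving_smul s⁻¹ μ)).toContinuousLinearMap

/-- The operator of multiplication by `f ∈ L^∞(Y, μ)` on `L²(Y, μ)`. -/
def mulLInfty {Y : Type*} [MeasurableSpace Y] (μ : Measure Y) (f : Lp ℂ ∞ μ) :
    Lp ℂ 2 μ →L[ℂ] Lp ℂ 2 μ :=
  (ContinuousLinearMap.mul ℂ ℂ).holderL μ ∞ 2 2 f

/-- The canonical unitary `u_s = σ_s ⊗ λ_s` on `ℓ²(Γ, L²(Y, μ)) = L²(Y, μ) ⊗ ℓ²(Γ)`: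
`(u_s ξ)(g) = σ_s (ξ (s⁻¹ g))`. -/
def crossedUnitary (s : Γ) : EllTwo Γ (Lp ℂ 2 μ) →L[ℂ] EllTwo Γ (Lp ℂ 2 μ) :=
  tensorShift (koopman μ s) s

/-- The copy `f ⊗ 1` of `f ∈ L^∞(Y, μ)` acting on `ℓ²(Γ, L²(Y, μ))`. -/
def crossedFunction (Γ : Type*) [Group Γ] {Y : Type*} [MeasurableSpace Y] (μ : Measure Y)
    (f : Lp ℂ ∞ μ) : EllTwo Γ (Lp ℂ 2 μ) →L[ℂ] EllTwo Γ (Lp ℂ 2 μ) :=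
  tensorShift (mulLInfty μ f) (1 : Γ)

variable (Γ)

/-- The group von Neumann algebra `L(Γ)`, realised inside the crossed product
`L^∞(Y, μ) ⋊ Γ` as the von Neumann algebra generated by the canonical unitaries. -/
def groupVN : VonNeumannAlgebra (EllTwo Γ (Lp ℂ 2 μ)) :=
  vonNeumannClosure (Set.range fun s : Γ => crossedUnitary μ s)

/-- The crossed product von Neumann algebra `L^∞(Y, μ) ⋊ Γ`, generated on
`L²(Y, μ) ⊗ ℓ²(Γ)` by the functions `f ⊗ 1` and the unitaries `u_s = σ_s ⊗ λ_s`. -/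
def crossedProduct : VonNeumannAlgebra (EllTwo Γ (Lp ℂ 2 μ)) :=
  vonNeumannClosure ((Set.range fun f : Lp ℂ ∞ μ => crossedFunction Γ μ f) ∪
    Set.range fun s : Γ => crossedUnitary μ s)

end CrossedProduct

/-! ### The action of `PSL₂(ℚ)` on the quotient of the dual of `ℚ²` -/

/-- The group `ℚ²`, written multiplicatively and given the discrete topology. -/
def RatSq : Type := Multiplicative (Fin 2 → ℚ)

instance : CommGroup RatSq := inferInstanceAs (CommGroup (Multiplicative (Fin 2 → ℚ)))

instance : TopologicalSpace RatSq := ⊥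

instance : DiscreteTopology RatSq := ⟨rfl⟩

/-- An element of `ℚ²` in additive notation, as an element of `RatSq`. -/
def RatSq.of (v : Fin 2 → ℚ) : RatSq := Multiplicative.ofAdd v

/-- Left multiplication by the matrix `g` on `ℚ²`. -/
def RatSq.mulVec (g : SL(2, ℚ)) : RatSq →ₜ* RatSq where
  toMonoidHom := AddMonoidHom.toMultiplicative (Matrix.mulVecLin g.1).toAddMonoidHom
  continuous_toFun := continuous_of_discreteTopology

/-- The compact group given by the Pontryagin dual of the discrete group `ℚ²`. -/
abbrev DualRatSq : Type := PontryaginDual RatSq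

instance : MeasurableSpace DualRatSq := borel _

instance : BorelSpace DualRatSq := ⟨rfl⟩

/-- The Haar probability measure on the dual of `ℚ²`. -/
def haarDual : Measure DualRatSq := Measure.haarMeasure ⊤

/-- The algebraic action of `SL₂(ℚ)` on the dual of `ℚ²`: `(g χ)(v) = χ (g⁻¹ v)`. -/
instance : MulAction SL(2, ℚ) DualRatSq where
  smul g χ := PontryaginDual.map (RatSq.mulVec g⁻¹) χ
  one_smul χ := by
    refine PontryaginDual.ext fun v => ?_
    change χ (RatSq.mulVec 1⁻¹ v) = χ v
    congr 1
    rw [inv_one]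
    exact Matrix.one_mulVec (Multiplicative.toAdd v)
  mul_smul g h χ := by
    refine PontryaginDual.ext fun v => ?_
    change χ (RatSq.mulVec (g * h)⁻¹ v) = χ (RatSq.mulVec h⁻¹ (RatSq.mulVec g⁻¹ v))
    congr 1
    rw [mul_inv_rev]
    exact (Matrix.mulVec_mulVec (Multiplicative.toAdd v) _ _).symm

theorem smul_dualRatSq_apply (g : SL(2, ℚ)) (χ : DualRatSq) (v : Fin 2 → ℚ) :
    (g • χ) (RatSq.of v) = χ (RatSq.of ((g⁻¹).1.mulVec v)) := rfl

/-- The relation on the dual of `ℚ²` that identifies `φ` with `v ↦ φ (-v)`. -/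
instance pmSetoid : Setoid DualRatSq where
  r φ ψ := ψ = φ ∨ ∀ v : Fin 2 → ℚ, ψ (RatSq.of v) = φ (RatSq.of (-v))
  iseqv :=
    { refl := fun φ => Or.inl rfl
      symm := by
        rintro φ ψ (h | h)
        · exact Or.inl h.symm
        · exact Or.inr fun v => by rw [h (-v), neg_neg]
      trans := by
        rintro φ ψ θ (h | h) (h' | h')
        · exact Or.inl (h'.trans h)
        · exact Or.inr fun v => by rw [h' v, h]
        · exact Or.inr fun v => by rw [h', h v]
        · refine Or.inl (PontryaginDual.ext fun v => ?_)
          have := h' (Multiplicative.toAdd v)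
          rw [h, neg_neg] at this
          exact this }

/-- The quotient `Y` of the dual of `ℚ²` by `φ ∼ φ(-·)`, with the quotient σ-algebra. -/
def DualQuot : Type := Quotient pmSetoid

instance : MeasurableSpace DualQuot := inferInstanceAs (MeasurableSpace (Quotient pmSetoid))

/-- The quotient map onto `Y`. -/
def DualQuot.mk (φ : DualRatSq) : DualQuot := Quotient.mk pmSetoid φ

theorem DualQuot.measurable_mk : Measurable DualQuot.mk := fun _ hs => hs

/-- The probability measure on `Y`, the image of Haar measure. -/
def DualQuot.measure : Measure DualQuot := haarDual.map DualQuot.mk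

/-- The quotient action of `SL₂(ℚ)` on `Y`: `g [φ] = [g φ]`. -/
instance : MulAction SL(2, ℚ) DualQuot where
  smul g := Quotient.map (g • ·) (by
    rintro φ ψ (h | h)
    · exact Or.inl (by rw [h])
    · refine Or.inr fun v => ?_
      simp only [smul_dualRatSq_apply, h, Matrix.mulVec_neg])
  one_smul := by
    rintro ⟨φ⟩
    exact congrArg DualQuot.mk (one_smul _ φ)
  mul_smul := by
    rintro g h ⟨φ⟩
    exact congrArg DualQuot.mk (mul_smul g h φ)

theorem DualQuot.smul_mk (g : SL(2, ℚ)) (φ : DualRatSq) :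
    g • DualQuot.mk φ = DualQuot.mk (g • φ) := rfl

/-- The centre `{±1}` of `SL₂(ℚ)` acts trivially on `Y`. -/
theorem DualQuot.center_smul (g : SL(2, ℚ)) (hg : g ∈ Subgroup.center SL(2, ℚ)) (y : DualQuot) :
    g • y = y := by
  obtain ⟨r, hr, hg⟩ := Matrix.SpecialLinearGroup.mem_center_iff.mp (inv_mem hg)
  obtain ⟨φ⟩ := y
  refine Quotient.sound (Setoid.symm ?_)
  have hmul : ∀ v : Fin 2 → ℚ, (g⁻¹).1.mulVec v = r • v := fun v => by
    rw [← hg]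
    simp
  have hr' : r = 1 ∨ r = -1 := sq_eq_one_iff.mp (by simpa using hr)
  rcases hr' with rfl | rfl
  · refine Or.inl (PontryaginDual.ext fun v => ?_)
    exact congrArg (fun w => φ (RatSq.of w)) ((hmul v).trans (one_smul _ _))
  · refine Or.inr fun v => ?_
    rw [smul_dualRatSq_apply, hmul, neg_smul, one_smul]

/-- The action of `PSL₂(ℚ)` on `Y` as a homomorphism to the permutations of `Y`. -/
def DualQuot.toPerm : PSL(2, ℚ) →* Equiv.Perm DualQuot :=
  QuotientGroup.lift _ (MulAction.toPermHom SL(2, ℚ) DualQuot) fun g hg =>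
    Equiv.ext fun y => DualQuot.center_smul g hg y

/-- The action of `PSL₂(ℚ)` on `Y` induced by the action of `SL₂(ℚ)`. -/
instance : MulAction PSL(2, ℚ) DualQuot := MulAction.compHom DualQuot DualQuot.toPerm

theorem DualQuot.coe_smul (g : SL(2, ℚ)) (y : DualQuot) :
    ((g : PSL(2, ℚ)) • y) = g • y := rfl

theorem measurePreserving_smul_dualRatSq (g : SL(2, ℚ)) :
    MeasurePreserving (fun χ : DualRatSq => g • χ) haarDual haarDual := by
  have : haarDual.IsHaarMeasure := by unfold haarDual; infer_instance
  exact MonoidHom.measurePreserving (μ := haarDual) (ν := haarDual)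
    (f := (PontryaginDual.map (RatSq.mulVec g⁻¹)).toMonoidHom)
    (PontryaginDual.map (RatSq.mulVec g⁻¹)).continuous_toFun
    (MulAction.surjective g) rfl

theorem DualQuot.measurePreserving_smul (g : SL(2, ℚ)) :
    MeasurePreserving (fun y : DualQuot => g • y) DualQuot.measure DualQuot.measure := by
  have hm : Measurable (fun y : DualQuot => g • y) := by
    intro s hs
    exact (measurePreserving_smul_dualRatSq g).measurable (DualQuot.measurable_mk hs)
  refine ⟨hm, ?_⟩
  unfold DualQuot.measure
  rw [Measure.map_map hm DualQuot.measurable_mk]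
  conv_rhs => rw [← (measurePreserving_smul_dualRatSq g).map_eq]
  rw [Measure.map_map DualQuot.measurable_mk (measurePreserving_smul_dualRatSq g).measurable]
  rfl

instance : MeasurableConstSMul PSL(2, ℚ) DualQuot where
  measurable_const_smul g := by
    obtain ⟨g, rfl⟩ := QuotientGroup.mk_surjective g
    exact (DualQuot.measurePreserving_smul g).measurable

instance : SMulInvariantMeasure PSL(2, ℚ) DualQuot DualQuot.measure where
  measure_preimage_smul g s hs := by
    obtain ⟨g, rfl⟩ := QuotientGroup.mk_surjective g
    exact (DualQuot.measurePreserving_smul g).measure_preimage hs.nullMeasurableSet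

end

/-! Write `M` for the crossed product, `Ω = δ₁ ⊗ 1` for its tracial vector, `J` for the modular
conjugation, and let `P` be an intermediate algebra. The orthogonal projection `e` onto the closure
of `P Ω` plays the part of the conditional expectation onto `P`. It commutes with `P` and with `J P
J`, hence is equivariant for `PSL₂(ℚ)`, and it satisfies the trace identity `inner_starProjection`.
Since `P` is recovered from the closure of `P Ω` (`mem_of_apply_mem`), it is enough to compute `e`
on the vectors `δ₁ ⊗ c_v`, where `c_v(χ) = χ(v) + χ(-v)`. These functions span a dense subspace of
`L²(Y)`, and `SL₂(ℚ)` permutes those with `v ≠ 0` transitively, so `v = e₁ = (1, 0)` suffices.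

The upper unipotents fix `e₁`. By equivariance, the norms of the group coefficients of `e(δ₁ ⊗
c_{e₁})` are constant along conjugation by them, and the Fourier coefficients of each surviving
coefficient are constant along their orbits. A summable family takes a non-zero value only finitely
often, so the group coefficients live on the upper unipotents and their Fourier modes on the
non-zero points of the line `ℚ e₁`.

The trace identity, applied to cosines and group elements chosen so that almost all terms vanish,
then does two things. It kills the coefficients at non-trivial unipotents
(`orbitProj_upperUnip_eq_zero`). For the remaining one it gives a multiplicative relation between
the Fourier coefficients (`coeff_functional_equation`), which with summability leaves only the modes
`± e₁`. Hence `e(δ₁ ⊗ c_{e₁}) = a (δ₁ ⊗ c_{e₁})`, and idempotence gives `a = 0` or `a = 1`. In the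
first case `P = L(PSL₂(ℚ))`, in the second `P = M`. -/

open scoped InnerProductSpace ComplexConjugate

/-! ### Von Neumann algebras with a tracial vector -/

section Tracial

variable {H : Type*} [NormedAddCommGroup H] [InnerProductSpace ℂ H]

/-- Polarization: by antilinearity `J x - i J y = J (x + i y)`, and `x + i y = i (y - i x)`, so the
four norms are those of the reversed inner product. -/
theorem LinearIsometry.inner_map_map_star (J : H →ₗᵢ⋆[ℂ] H) (x y : H) :
    ⟪J x, J y⟫_ℂ = ⟪y, x⟫_ℂ := by
  have hI : ∀ z : H, J (Complex.I • z) = -(Complex.I • J z) := fun z => by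
    rw [map_smulₛₗ]; simp
  have h1 : ‖J x + J y‖ = ‖y + x‖ := by rw [← map_add, J.norm_map, add_comm]
  have h2 : ‖J x - J y‖ = ‖y - x‖ := by rw [← map_sub, J.norm_map, norm_sub_rev]
  have h3 : ‖J x - Complex.I • J y‖ = ‖y - Complex.I • x‖ := by
    have : J x - Complex.I • J y = J (x + Complex.I • y) := by rw [map_add, hI]; abel
    rw [this, J.norm_map]
    have : x + Complex.I • y = Complex.I • (y - Complex.I • x) := by
      rw [smul_sub, smul_smul, Complex.I_mul_I]; simp [add_comm]
    rw [this, norm_smul]; simp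
  have h4 : ‖J x + Complex.I • J y‖ = ‖y + Complex.I • x‖ := by
    have : J x + Complex.I • J y = J (x - Complex.I • y) := by rw [map_sub, hI]; abel
    rw [this, J.norm_map]
    have : x - Complex.I • y = -(Complex.I • (y + Complex.I • x)) := by
      rw [smul_add, smul_smul, Complex.I_mul_I]; simp; abel
    rw [this, norm_neg, norm_smul]; simp
  rw [inner_eq_sum_norm_sq_div_four, inner_eq_sum_norm_sq_div_four]
  simp only [RCLike.I_to_complex, h1, h2, h3, h4]

/-- Only additivity of `T` matters, so that the same lemma serves the operators of `P` and the
antilinear `J`. -/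
theorem Submodule.starProjection_map_comm (K : Submodule ℂ H) [K.HasOrthogonalProjection]
    {F : Type*} [FunLike F H H] [AddMonoidHomClass F H H] (T : F) (hK : ∀ x ∈ K, T x ∈ K)
    (hK' : ∀ x ∈ Kᗮ, T x ∈ Kᗮ) (x : H) : K.starProjection (T x) = T (K.starProjection x) := by
  refine (K.eq_starProjection_of_mem_orthogonal (hK _ (K.starProjection_apply_mem x)) ?_)
  rw [← map_sub]
  exact hK' _ (K.sub_starProjection_mem_orthogonal x)

variable [CompleteSpace H]

namespace VonNeumannAlgebra

/-- The closure of the orbit `P Ω`. -/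
noncomputable def orbitClosure (P : VonNeumannAlgebra H) (Ω : H) : Submodule ℂ H :=
  (P.toStarSubalgebra.toSubalgebra.toSubmodule.map
    (ContinuousLinearMap.apply ℂ H Ω).toLinearMap).topologicalClosure

variable {P : VonNeumannAlgebra H} {Ω : H}

theorem apply_mem_orbitClosure {x : H →L[ℂ] H} (hx : x ∈ P) : x Ω ∈ P.orbitClosure Ω :=
  Submodule.le_topologicalClosure _ ⟨x, hx, rfl⟩

theorem isClosed_orbitClosure : IsClosed (P.orbitClosure Ω : Set H) :=
  Submodule.isClosed_topologicalClosure _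

instance : (P.orbitClosure Ω).HasOrthogonalProjection := by
  have : CompleteSpace (P.orbitClosure Ω) := isClosed_orbitClosure.completeSpace_coe
  infer_instance

theorem orbitClosure_induction {p : H → Prop} (hp : IsClosed {η | p η})
    (h : ∀ x ∈ P, p (x Ω)) {η : H} (hη : η ∈ P.orbitClosure Ω) : p η := by
  refine closure_minimal (t := {η | p η}) ?_ hp hη
  rintro _ ⟨x, hx, rfl⟩
  exact h x hx

theorem map_mem_orbitClosure {x : H →L[ℂ] H} (hx : x ∈ P) {η : H} (hη : η ∈ P.orbitClosure Ω) :
    x η ∈ P.orbitClosure Ω := by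
  refine orbitClosure_induction (p := fun η => x η ∈ P.orbitClosure Ω)
    (isClosed_orbitClosure.preimage x.continuous) (fun y hy => ?_) hη
  exact apply_mem_orbitClosure (x := x * y) (mul_mem hx hy)

theorem starProjection_orbitClosure_map {x : H →L[ℂ] H} (hx : x ∈ P) (η : H) :
    (P.orbitClosure Ω).starProjection (x η) = x ((P.orbitClosure Ω).starProjection η) := by
  refine Submodule.starProjection_map_comm _ x (fun _ h => map_mem_orbitClosure hx h) ?_ η
  intro η hη
  rw [Submodule.mem_orthogonal] at hη ⊢
  intro k hk
  rw [← ContinuousLinearMap.adjoint_inner_left]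
  exact hη _ (map_mem_orbitClosure (star_mem hx) hk)

/-- `Ω` is a tracial vector of `M`, separating for `M`, and `J` is the modular conjugation. -/
structure IsModularConjugation (M : VonNeumannAlgebra H) (J : H →ₗᵢ⋆[ℂ] H) (Ω : H) : Prop where
  involutive : ∀ x, J (J x) = x
  map_apply : ∀ a ∈ M, J (a Ω) = (star a) Ω
  -- Totality of `M' Ω`, that is, `Ω` is cyclic for the commutant; this is equivalent to `Ω` being
  -- separating for `M`.
  separating : ∀ ζ, (∀ r ∈ M.commutant, ⟪r Ω, ζ⟫_ℂ = 0) → ζ = 0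

variable {M : VonNeumannAlgebra H} {J : H →ₗᵢ⋆[ℂ] H}

theorem mem_commutant_apply {r x : H →L[ℂ] H} (hr : r ∈ M.commutant) (hx : x ∈ M) (ζ : H) :
    x (r ζ) = r (x ζ) :=
  congrArg (fun T : H →L[ℂ] H => T ζ) (mem_commutant_iff.mp hr x hx)

/-- The operators `J a J` with `a ∈ T` lie in the commutant, and `J a J Ω = J a Ω` runs through a
total set. Moving `x ∈ M` across `J a J` shows that `x Ω - J x* Ω` is orthogonal to every `a Ω`.
Thus the formula for `J` passes from the explicit family `T` to all of `M` without a density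
argument. -/
theorem IsModularConjugation.of_total (hJ : ∀ x, J (J x) = x) (hΩ : J Ω = Ω)
    (T : Set (H →L[ℂ] H)) (hTΩ : ∀ a ∈ T, J (a Ω) = (star a) Ω)
    (hcomm : ∀ a ∈ T, ∀ x ∈ M, ∀ ζ, J (a (J (x ζ))) = x (J (a (J ζ))))
    (htot : ∀ ζ, (∀ a ∈ T, ⟪a Ω, ζ⟫_ℂ = 0) → ζ = 0) : M.IsModularConjugation J Ω where
  involutive := hJ
  separating ζ h := by
    rw [← hJ ζ, htot (J ζ) fun a ha => ?_, map_zero]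
    have hmem : (J.toContinuousLinearMap.comp (a.comp J.toContinuousLinearMap) : H →L[ℂ] H) ∈
        M.commutant := by
      rw [mem_commutant_iff]
      intro x hx
      ext ζ
      exact (hcomm a ha x hx ζ).symm
    have := h _ hmem
    simp only [ContinuousLinearMap.comp_apply, LinearIsometry.coe_toContinuousLinearMap, hΩ] at this
    rw [← hJ (a Ω), J.inner_map_map_star, ← inner_conj_symm, this, map_zero]
  map_apply x hx := by
    rw [← hJ ((star x) Ω), sub_eq_zero.mp (htot (x Ω - J (star x Ω)) fun a ha => ?_)]
    rw [inner_sub_right, sub_eq_zero]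
    calc ⟪a Ω, x Ω⟫_ℂ = ⟪J (x Ω), J (a Ω)⟫_ℂ := (J.inner_map_map_star _ _).symm
      _ = ⟪J (x Ω), star a Ω⟫_ℂ := by rw [hTΩ a ha]
      _ = ⟪a (J (x Ω)), Ω⟫_ℂ := by
        rw [ContinuousLinearMap.star_eq_adjoint, ContinuousLinearMap.adjoint_inner_right]
      _ = ⟪Ω, x (J (a Ω))⟫_ℂ := by
        rw [← J.inner_map_map_star, hcomm a ha x hx, hΩ]
      _ = ⟪star x Ω, J (a Ω)⟫_ℂ := by
        rw [ContinuousLinearMap.star_eq_adjoint, ContinuousLinearMap.adjoint_inner_left]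
      _ = ⟪a Ω, J (star x Ω)⟫_ℂ := by rw [← J.inner_map_map_star, hJ]

namespace IsModularConjugation

theorem eq_of_forall_inner (h : M.IsModularConjugation J Ω) {A B : H →L[ℂ] H}
    (hAB : ∀ r ∈ M.commutant, ∀ r' ∈ M.commutant, ⟪r' Ω, A (r Ω)⟫_ℂ = ⟪r' Ω, B (r Ω)⟫_ℂ) :
    A = B := by
  have h0 : ContinuousLinearMap.adjoint (A - B) = 0 := by
    ext η
    refine h.separating _ fun r hr => ?_
    have : (A - B) (r Ω) = 0 := h.separating _ fun r' hr' => by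
      rw [sub_apply, inner_sub_right, hAB r hr r' hr', sub_self]
    rw [ContinuousLinearMap.adjoint_inner_right, this, inner_zero_left]
  rw [← sub_eq_zero, ← ContinuousLinearMap.adjoint_adjoint (A - B), h0, map_zero]

/-- An element `x` of `M` with `x Ω` in the closure of `P Ω` belongs to `P`. -/
theorem mem_of_apply_mem (h : M.IsModularConjugation J Ω) (hP : P ≤ M) {x : H →L[ℂ] H}
    (hx : x ∈ M) (hxP : x Ω ∈ P.orbitClosure Ω) : x ∈ P := by
  rw [← SetLike.mem_coe, ← P.centralizer_centralizer]
  intro c hc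
  refine h.eq_of_forall_inner fun r hr r' hr' => ?_
  -- By the bicommutant theorem `x` must commute with `c ∈ P'`. Against vectors of `M' Ω`, the
  -- coefficients of `y c` and `c y` depend on `y` only through `y Ω`, and continuously so; the
  -- equality known for `y ∈ P` therefore extends to the closure of `P Ω`.
  have key : ∀ y ∈ M, ⟪r' (J (y Ω)), c (r Ω)⟫_ℂ = ⟪r' Ω, y (c (r Ω))⟫_ℂ ∧
      ⟪r' Ω, c (r (y Ω))⟫_ℂ = ⟪r' Ω, c (y (r Ω))⟫_ℂ := fun y hy => by
    rw [h.map_apply y hy, ← mem_commutant_apply hr' (star_mem hy), mem_commutant_apply hr hy,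
      ContinuousLinearMap.star_eq_adjoint, ContinuousLinearMap.adjoint_inner_left]
    exact ⟨rfl, rfl⟩
  have hcl : ⟪r' (J (x Ω)), c (r Ω)⟫_ℂ = ⟪r' Ω, c (r (x Ω))⟫_ℂ := by
    refine orbitClosure_induction
      (p := fun η => ⟪r' (J η), c (r Ω)⟫_ℂ = ⟪r' Ω, c (r η)⟫_ℂ) ?_ (fun y hy => ?_) hxP
    · have := J.continuous
      exact isClosed_eq (by fun_prop) (by fun_prop)
    · rw [(key y (hP hy)).1, (key y (hP hy)).2]
      exact congrArg (fun T : H →L[ℂ] H => ⟪r' Ω, T (r Ω)⟫_ℂ) (hc y hy)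
  rw [(key x hx).1, (key x hx).2] at hcl
  exact hcl.symm

theorem map_mem_orbitClosure (h : M.IsModularConjugation J Ω) (hP : P ≤ M) {η : H}
    (hη : η ∈ P.orbitClosure Ω) : J η ∈ P.orbitClosure Ω := by
  refine orbitClosure_induction (p := fun η => J η ∈ P.orbitClosure Ω)
    (isClosed_orbitClosure.preimage J.continuous) (fun x hx => ?_) hη
  rw [h.map_apply x (hP hx)]
  exact apply_mem_orbitClosure (star_mem hx)

theorem starProjection_map (h : M.IsModularConjugation J Ω) (hP : P ≤ M) (η : H) :
    (P.orbitClosure Ω).starProjection (J η) = J ((P.orbitClosure Ω).starProjection η) := by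
  refine Submodule.starProjection_map_comm _ J (fun _ hη => h.map_mem_orbitClosure hP hη) ?_ η
  intro η hη
  rw [Submodule.mem_orthogonal] at hη ⊢
  intro k hk
  rw [← h.involutive k, J.inner_map_map_star, ← inner_conj_symm,
    hη _ (h.map_mem_orbitClosure hP hk), map_zero]

/-- `J x* y* Ω = J (y x)* Ω`. This realises right multiplication by `x` on `M Ω` as the bounded
operator `J x* J`. -/
theorem conj_apply (h : M.IsModularConjugation J Ω) {x y : H →L[ℂ] H} (hx : x ∈ M) (hy : y ∈ M) :
    J (star x (J (y Ω))) = y (x Ω) := by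
  rw [h.map_apply y hy, ← h.involutive (y (x Ω))]
  have := h.map_apply (y * x) (mul_mem hy hx)
  rw [star_mul] at this
  exact congrArg J this.symm

theorem starProjection_conj (h : M.IsModularConjugation J Ω) (hP : P ≤ M) {x : H →L[ℂ] H}
    (hx : x ∈ P) (η : H) :
    (P.orbitClosure Ω).starProjection (J (x (J η))) =
      J (x (J ((P.orbitClosure Ω).starProjection η))) := by
  rw [h.starProjection_map hP, starProjection_orbitClosure_map hx, h.starProjection_map hP]

/-- The trace identity behind the bimodularity of the conditional expectation onto `P`. -/
theorem inner_starProjection (h : M.IsModularConjugation J Ω) (hP : P ≤ M) {b f : H →L[ℂ] H}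
    (hb : b ∈ M) (hf : f ∈ M) {η : H} (hη : η ∈ P.orbitClosure Ω) :
    ⟪(P.orbitClosure Ω).starProjection (b Ω), f η⟫_ℂ =
      ⟪b (J η), (P.orbitClosure Ω).starProjection (f Ω)⟫_ℂ := by
  refine orbitClosure_induction (p := fun η => ⟪(P.orbitClosure Ω).starProjection (b Ω), f η⟫_ℂ =
      ⟪b (J η), (P.orbitClosure Ω).starProjection (f Ω)⟫_ℂ) ?_ (fun x hx => ?_) hη
  · have := J.continuous
    exact isClosed_eq (by fun_prop) (by fun_prop)
  · have hx' := hP hx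
    -- For `η = x Ω` one has `f η = J x* J f Ω`. As `x ∈ P`, the operator `J x* J` commutes with the
    -- projection; its adjoint `J x J` then sends `b Ω` to `b x* Ω = b J η`.
    rw [← h.conj_apply hx' hf, Submodule.inner_starProjection_left_eq_right,
      h.starProjection_conj hP (star_mem hx), h.map_apply x hx', ← h.conj_apply (star_mem hx') hb,
      star_star]
    rw [← h.involutive (b Ω), J.inner_map_map_star, ContinuousLinearMap.star_eq_adjoint,
      ContinuousLinearMap.adjoint_inner_left, h.involutive, ← J.inner_map_map_star, h.involutive]

end IsModularConjugation

end VonNeumannAlgebra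

end Tracial

noncomputable section

/-! ### The tracial vector of a crossed product -/

section LpStar

variable {Y : Type*} [MeasurableSpace Y] {μ : Measure Y}

/-- Complex conjugation on `L²(Y, μ)`. -/
def conjLTwo (μ : Measure Y) : Lp ℂ 2 μ →ₗᵢ⋆[ℂ] Lp ℂ 2 μ where
  toFun φ := star φ
  map_add' φ ψ := by
    apply Lp.ext
    filter_upwards [Lp.coeFn_star (φ + ψ), Lp.coeFn_star φ, Lp.coeFn_star ψ, Lp.coeFn_add φ ψ,
      Lp.coeFn_add (star φ) (star ψ)] with y h1 h2 h3 h4 h5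
    rw [h1, h5, Pi.star_apply, h4, Pi.add_apply, Pi.add_apply, h2, h3, star_add]
    rfl
  map_smul' c φ := by
    apply Lp.ext
    filter_upwards [Lp.coeFn_star (c • φ), Lp.coeFn_star φ, Lp.coeFn_smul c φ,
      Lp.coeFn_smul (conj c) (star φ)] with y h1 h2 h3 h4
    simp [h1, h2, h3, h4]
  norm_map' φ := by
    rw [Lp.norm_def, Lp.norm_def]
    refine congrArg ENNReal.toReal (eLpNorm_congr_norm_ae ?_)
    filter_upwards [Lp.coeFn_star φ] with y h
    simp [h]

theorem coeFn_conjLTwo (φ : Lp ℂ 2 μ) : conjLTwo μ φ =ᵐ[μ] fun y => conj (φ y) :=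
  Lp.coeFn_star φ

theorem conjLTwo_conjLTwo (φ : Lp ℂ 2 μ) : conjLTwo μ (conjLTwo μ φ) = φ :=
  star_star φ

theorem coeFn_mulLInfty (f : Lp ℂ ∞ μ) (φ : Lp ℂ 2 μ) :
    mulLInfty μ f φ =ᵐ[μ] fun y => f y * φ y :=
  (ContinuousLinearMap.mul ℂ ℂ).coeFn_holder f φ

theorem mulLInfty_comm (f f' : Lp ℂ ∞ μ) (φ : Lp ℂ 2 μ) :
    mulLInfty μ f (mulLInfty μ f' φ) = mulLInfty μ f' (mulLInfty μ f φ) := by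
  apply Lp.ext
  filter_upwards [coeFn_mulLInfty f (mulLInfty μ f' φ), coeFn_mulLInfty f' (mulLInfty μ f φ),
    coeFn_mulLInfty f φ, coeFn_mulLInfty f' φ] with y h1 h2 h3 h4
  rw [h1, h2, h3, h4]; ring

theorem conjLTwo_mulLInfty (f : Lp ℂ ∞ μ) (φ : Lp ℂ 2 μ) :
    conjLTwo μ (mulLInfty μ f φ) = mulLInfty μ (star f) (conjLTwo μ φ) := by
  apply Lp.ext
  filter_upwards [coeFn_mulLInfty f φ, coeFn_mulLInfty (star f) (conjLTwo μ φ),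
    coeFn_conjLTwo φ, coeFn_conjLTwo (mulLInfty μ f φ), Lp.coeFn_star f] with y h1 h2 h3 h4 h5
  simp [h1, h2, h3, h4, h5]

theorem inner_mulLInfty_left (f : Lp ℂ ∞ μ) (φ ψ : Lp ℂ 2 μ) :
    ⟪mulLInfty μ f φ, ψ⟫_ℂ = ⟪φ, mulLInfty μ (star f) ψ⟫_ℂ := by
  rw [L2.inner_def, L2.inner_def]
  refine integral_congr_ae ?_
  filter_upwards [coeFn_mulLInfty f φ, coeFn_mulLInfty (star f) ψ, Lp.coeFn_star f] with y h1 h2 h3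
  simp only [h1, h2, h3, RCLike.inner_apply, map_mul, Pi.star_apply, RCLike.star_def]
  ring

theorem mulLInfty_indicator [IsFiniteMeasure μ] {s : Set Y} (hs : MeasurableSet s) :
    mulLInfty μ (indicatorConstLp ∞ hs (measure_ne_top μ s) (1 : ℂ)) (Lp.const 2 μ (1 : ℂ)) =
      indicatorConstLp 2 hs (measure_ne_top μ s) (1 : ℂ) := by
  apply Lp.ext
  filter_upwards [coeFn_mulLInfty (indicatorConstLp ∞ hs (measure_ne_top μ s) (1 : ℂ))
    (Lp.const 2 μ (1 : ℂ)), indicatorConstLp_coeFn (p := ∞) (hs := hs)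
    (hμs := measure_ne_top μ s) (c := (1 : ℂ)), indicatorConstLp_coeFn (p := 2) (hs := hs)
    (hμs := measure_ne_top μ s) (c := (1 : ℂ)), Lp.coeFn_const 2 μ (1 : ℂ)] with y h1 h2 h3 h4
  rw [h1, h2, h3, h4]; simp

theorem eq_zero_of_forall_inner_mulLInfty [IsFiniteMeasure μ] {φ : Lp ℂ 2 μ}
    (h : ∀ f : Lp ℂ ∞ μ, ⟪mulLInfty μ f (Lp.const 2 μ (1 : ℂ)), φ⟫_ℂ = 0) : φ = 0 := by
  rw [Lp.eq_zero_iff_ae_eq_zero]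
  refine Lp.ae_eq_zero_of_forall_setIntegral_eq_zero φ (by norm_num) (by norm_num)
    (fun s _ _ => ((Lp.memLp φ).integrable (by norm_num)).integrableOn) fun s hs _ => ?_
  have := h (indicatorConstLp ∞ hs (measure_ne_top μ s) (1 : ℂ))
  rwa [mulLInfty_indicator, L2.inner_indicatorConstLp_one] at this

end LpStar

/-! ### The vectors `δ_g ⊗ φ` and the action of functions on them. -/

section CrossedFunction

variable {Γ Y : Type*} [MeasurableSpace Y] {μ : Measure Y}

open Classical in
/-- The vector `δ_g ⊗ φ` of `ℓ²(Γ, L²(Y, μ))`. -/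
def deltaTensor (g : Γ) (φ : Lp ℂ 2 μ) : EllTwo Γ (Lp ℂ 2 μ) := lp.single 2 g φ

theorem deltaTensor_self (g : Γ) (φ : Lp ℂ 2 μ) : deltaTensor g φ g = φ := by
  simp [deltaTensor]

theorem deltaTensor_of_ne {g k : Γ} (h : k ≠ g) (φ : Lp ℂ 2 μ) : deltaTensor g φ k = 0 := by
  simp [deltaTensor, h]

theorem inner_deltaTensor_left (g : Γ) (φ : Lp ℂ 2 μ) (ξ : EllTwo Γ (Lp ℂ 2 μ)) :
    ⟪deltaTensor g φ, ξ⟫_ℂ = ⟪φ, ξ g⟫_ℂ := by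
  classical exact lp.inner_single_left (𝕜 := ℂ) g φ ξ

theorem inner_deltaTensor_right (g : Γ) (φ : Lp ℂ 2 μ) (ξ : EllTwo Γ (Lp ℂ 2 μ)) :
    ⟪ξ, deltaTensor g φ⟫_ℂ = ⟪ξ g, φ⟫_ℂ := by
  classical exact lp.inner_single_right (𝕜 := ℂ) g φ ξ

variable [Group Γ]

theorem crossedFunction_apply (f : Lp ℂ ∞ μ) (g : Γ) (ξ : EllTwo Γ (Lp ℂ 2 μ)) :
    crossedFunction Γ μ f ξ g = mulLInfty μ f (ξ g) := by
  change mulLInfty μ f (ξ (1⁻¹ * g)) = _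
  rw [inv_one, one_mul]

theorem star_crossedFunction (f : Lp ℂ ∞ μ) :
    star (crossedFunction Γ μ f) = crossedFunction Γ μ (star f) := by
  rw [ContinuousLinearMap.star_eq_adjoint, eq_comm, ContinuousLinearMap.eq_adjoint_iff]
  intro ξ η
  rw [lp.inner_eq_tsum, lp.inner_eq_tsum]
  refine (tsum_congr fun g => ?_)
  rw [crossedFunction_apply, crossedFunction_apply, inner_mulLInfty_left, star_star]

theorem crossedFunction_single (f : Lp ℂ ∞ μ) (g : Γ) (φ : Lp ℂ 2 μ) :
    crossedFunction Γ μ f (deltaTensor g φ) = deltaTensor g (mulLInfty μ f φ) := by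
  ext1; funext k
  rw [crossedFunction_apply]
  by_cases h : k = g
  · subst h; simp [deltaTensor_self]
  · simp [deltaTensor_of_ne h]

variable (Γ μ) in
/-- The canonical tracial vector `δ₁ ⊗ 1`. -/
def crossedVector [IsFiniteMeasure μ] : EllTwo Γ (Lp ℂ 2 μ) :=
  deltaTensor (1 : Γ) (Lp.const 2 μ (1 : ℂ))

theorem crossedFunction_crossedVector [IsFiniteMeasure μ] (f : Lp ℂ ∞ μ) :
    crossedFunction Γ μ f (crossedVector Γ μ) =
      deltaTensor 1 (mulLInfty μ f (Lp.const 2 μ (1 : ℂ))) :=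
  crossedFunction_single f 1 _

end CrossedFunction

/-! ### Koopman operators, canonical unitaries and the modular conjugation of the crossed product.
-/

section Koopman

variable {Γ Y : Type*} [Group Γ] [MeasurableSpace Y] [MulAction Γ Y] [MeasurableConstSMul Γ Y]
  {μ : Measure Y} [SMulInvariantMeasure Γ Y μ]

/-- The action of `s` on `L^∞(Y, μ)`. -/
def koopmanLInfty (μ : Measure Y) [SMulInvariantMeasure Γ Y μ] (s : Γ) (f : Lp ℂ ∞ μ) :
    Lp ℂ ∞ μ :=
  Lp.compMeasurePreserving (fun y : Y => s⁻¹ • y) (measurePreserving_smul s⁻¹ μ) f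

theorem coeFn_koopmanLInfty (s : Γ) (f : Lp ℂ ∞ μ) :
    koopmanLInfty μ s f =ᵐ[μ] fun y => f (s⁻¹ • y) :=
  Lp.coeFn_compMeasurePreserving f (measurePreserving_smul s⁻¹ μ)

theorem coeFn_koopman (s : Γ) (φ : Lp ℂ 2 μ) : koopman μ s φ =ᵐ[μ] fun y => φ (s⁻¹ • y) :=
  Lp.coeFn_compMeasurePreserving φ (measurePreserving_smul s⁻¹ μ)

theorem ae_smul {p : Y → Prop} (s : Γ) (h : ∀ᵐ y ∂μ, p y) : ∀ᵐ y ∂μ, p (s • y) :=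
  (measurePreserving_smul s μ).quasiMeasurePreserving.ae h

theorem koopman_koopman (s t : Γ) (φ : Lp ℂ 2 μ) :
    koopman μ s (koopman μ t φ) = koopman μ (s * t) φ := by
  apply Lp.ext
  filter_upwards [coeFn_koopman s (koopman μ t φ), ae_smul s⁻¹ (coeFn_koopman t φ),
    coeFn_koopman (s * t) φ] with y h1 h2 h3
  rw [h1, h2, h3, mul_inv_rev, mul_smul]

theorem koopman_one (φ : Lp ℂ 2 μ) : koopman μ (1 : Γ) φ = φ := by
  apply Lp.ext
  filter_upwards [coeFn_koopman (1 : Γ) φ] with y h1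
  rw [h1, inv_one, one_smul]

theorem norm_koopman (s : Γ) (φ : Lp ℂ 2 μ) : ‖koopman μ s φ‖ = ‖φ‖ :=
  Lp.norm_compMeasurePreserving φ (measurePreserving_smul s⁻¹ μ)

theorem koopman_const [IsFiniteMeasure μ] (s : Γ) (c : ℂ) :
    koopman μ s (Lp.const 2 μ c) = Lp.const 2 μ c := by
  apply Lp.ext
  filter_upwards [coeFn_koopman s (Lp.const 2 μ c), Lp.coeFn_const 2 μ c,
    ae_smul s⁻¹ (Lp.coeFn_const 2 μ c)] with y h1 h2 h3
  rw [h1, h2, h3]; rfl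

theorem conjLTwo_const_one [IsFiniteMeasure μ] :
    conjLTwo μ (Lp.const 2 μ (1 : ℂ)) = Lp.const 2 μ (1 : ℂ) := by
  apply Lp.ext
  filter_upwards [coeFn_conjLTwo (Lp.const 2 μ (1 : ℂ)), Lp.coeFn_const 2 μ (1 : ℂ)] with y h1 h2
  rw [h1, h2]; simp

theorem inner_koopman_left (s : Γ) (φ ψ : Lp ℂ 2 μ) :
    ⟪koopman μ s φ, ψ⟫_ℂ = ⟪φ, koopman μ s⁻¹ ψ⟫_ℂ := by
  have h : ψ = koopman μ s (koopman μ s⁻¹ ψ) := by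
    rw [koopman_koopman, mul_inv_cancel, koopman_one]
  conv_lhs => rw [h]
  exact LinearIsometry.inner_map_map (𝕜 := ℂ) (Lp.compMeasurePreservingₗᵢ (E := ℂ) (p := 2) ℂ
    (fun y : Y => s⁻¹ • y) (measurePreserving_smul s⁻¹ μ)) _ _

theorem koopman_conjLTwo (s : Γ) (φ : Lp ℂ 2 μ) :
    koopman μ s (conjLTwo μ φ) = conjLTwo μ (koopman μ s φ) := by
  apply Lp.ext
  filter_upwards [coeFn_koopman s (conjLTwo μ φ), ae_smul s⁻¹ (coeFn_conjLTwo φ),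
    coeFn_conjLTwo (koopman μ s φ), coeFn_koopman s φ] with y h1 h2 h3 h4
  rw [h1, h2, h3, h4]

theorem koopman_mulLInfty (s : Γ) (f : Lp ℂ ∞ μ) (φ : Lp ℂ 2 μ) :
    koopman μ s (mulLInfty μ f φ) = mulLInfty μ (koopmanLInfty μ s f) (koopman μ s φ) := by
  apply Lp.ext
  filter_upwards [coeFn_koopman s (mulLInfty μ f φ), ae_smul s⁻¹ (coeFn_mulLInfty f φ),
    coeFn_mulLInfty (koopmanLInfty μ s f) (koopman μ s φ), coeFn_koopman s φ,
    coeFn_koopmanLInfty s f] with y h1 h2 h3 h4 h5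
  rw [h1, h2, h3, h4, h5]

theorem koopmanLInfty_koopmanLInfty (s t : Γ) (f : Lp ℂ ∞ μ) :
    koopmanLInfty μ s (koopmanLInfty μ t f) = koopmanLInfty μ (s * t) f := by
  apply Lp.ext
  filter_upwards [coeFn_koopmanLInfty s (koopmanLInfty μ t f),
    ae_smul s⁻¹ (coeFn_koopmanLInfty t f), coeFn_koopmanLInfty (s * t) f] with y h1 h2 h3
  rw [h1, h2, h3, mul_inv_rev, mul_smul]

theorem crossedUnitary_apply (s g : Γ) (ξ : EllTwo Γ (Lp ℂ 2 μ)) :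
    crossedUnitary μ s ξ g = koopman μ s (ξ (s⁻¹ * g)) := rfl

theorem star_crossedUnitary (s : Γ) : star (crossedUnitary μ s) = crossedUnitary μ s⁻¹ := by
  rw [ContinuousLinearMap.star_eq_adjoint, eq_comm, ContinuousLinearMap.eq_adjoint_iff]
  intro ξ η
  have key : ∀ g, ⟪crossedUnitary μ s⁻¹ ξ g, η g⟫_ℂ =
      ⟪ξ (s * g), crossedUnitary μ s η (s * g)⟫_ℂ := fun g => by
    rw [crossedUnitary_apply, crossedUnitary_apply, inner_koopman_left, inv_inv,
      inv_mul_cancel_left]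
  rw [lp.inner_eq_tsum, lp.inner_eq_tsum, tsum_congr key]
  exact (Equiv.mulLeft s).tsum_eq fun g => ⟪ξ g, crossedUnitary μ s η g⟫_ℂ

variable (Γ μ)

/-- The modular conjugation of `L^∞(Y, μ) ⋊ Γ`. -/
def crossedConj : EllTwo Γ (Lp ℂ 2 μ) →ₗᵢ⋆[ℂ] EllTwo Γ (Lp ℂ 2 μ) :=
  have hnorm : ∀ (ξ : EllTwo Γ (Lp ℂ 2 μ)) (g : Γ),
      ‖koopman μ g (conjLTwo μ (ξ g⁻¹))‖ = ‖ξ g⁻¹‖ := fun ξ g => by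
    rw [norm_koopman, LinearIsometry.norm_map]
  have hmem : ∀ ξ : EllTwo Γ (Lp ℂ 2 μ),
      Memℓp (fun g : Γ => koopman μ g (conjLTwo μ (ξ g⁻¹))) 2 := fun ξ => by
    refine memℓp_gen ?_
    simp_rw [hnorm]
    exact (Equiv.inv Γ).summable_iff.mpr ((lp.memℓp ξ).summable (by norm_num))
  { toFun := fun ξ => ⟨fun g => koopman μ g (conjLTwo μ (ξ g⁻¹)), hmem ξ⟩
    map_add' := fun ξ η => by
      ext1; funext g
      change koopman μ g (conjLTwo μ (ξ g⁻¹ + η g⁻¹)) = _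
      rw [map_add, map_add]
      rfl
    map_smul' := fun c ξ => by
      ext1; funext g
      change koopman μ g (conjLTwo μ (c • ξ g⁻¹)) = _
      rw [map_smulₛₗ, map_smul]
      rfl
    norm_map' := fun ξ => by
      rw [lp.norm_eq_tsum_rpow (by norm_num), lp.norm_eq_tsum_rpow (by norm_num)]
      congr 1
      rw [← (Equiv.inv Γ).tsum_eq]
      refine tsum_congr fun g => ?_
      change ‖koopman μ g⁻¹ (conjLTwo μ (ξ g⁻¹⁻¹))‖ ^ _ = _
      rw [hnorm, inv_inv] }

variable {Γ μ}

theorem crossedConj_apply (ξ : EllTwo Γ (Lp ℂ 2 μ)) (g : Γ) :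
    crossedConj Γ μ ξ g = koopman μ g (conjLTwo μ (ξ g⁻¹)) := rfl

theorem crossedConj_crossedConj (ξ : EllTwo Γ (Lp ℂ 2 μ)) :
    crossedConj Γ μ (crossedConj Γ μ ξ) = ξ := by
  ext1; funext g
  rw [crossedConj_apply, crossedConj_apply, ← koopman_conjLTwo, koopman_koopman,
    conjLTwo_conjLTwo, mul_inv_cancel, koopman_one, inv_inv]

/-- Conjugation by `J` turns left multiplication into right multiplication: a pointwise multiplier
after a right translation, a form in which commutation with the generators of the crossed product is
visible. -/
theorem crossedConj_conj_apply (f : Lp ℂ ∞ μ) (s : Γ) (ξ : EllTwo Γ (Lp ℂ 2 μ)) (g : Γ) :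
    crossedConj Γ μ ((crossedFunction Γ μ f * crossedUnitary μ s) (crossedConj Γ μ ξ)) g =
      mulLInfty μ (koopmanLInfty μ g (star f)) (ξ (g * s)) := by
  rw [crossedConj_apply, mul_apply_eq_comp, crossedFunction_apply,
    crossedUnitary_apply, crossedConj_apply, conjLTwo_mulLInfty, koopman_mulLInfty,
    koopman_koopman, ← koopman_conjLTwo, conjLTwo_conjLTwo, koopman_koopman]
  simp [koopman_one]

theorem crossedUnitary_single (s g : Γ) (φ : Lp ℂ 2 μ) :
    crossedUnitary μ s (deltaTensor g φ) = deltaTensor (s * g) (koopman μ s φ) := by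
  ext1; funext k
  rw [crossedUnitary_apply]
  by_cases h : k = s * g
  · subst h; simp [deltaTensor_self]
  · have : s⁻¹ * k ≠ g := fun h' => h (by rw [← h']; group)
    simp [deltaTensor_of_ne h, deltaTensor_of_ne this]

theorem crossedConj_single (g : Γ) (φ : Lp ℂ 2 μ) :
    crossedConj Γ μ (deltaTensor g φ) = deltaTensor g⁻¹ (koopman μ g⁻¹ (conjLTwo μ φ)) := by
  ext1; funext k
  rw [crossedConj_apply]
  by_cases h : k = g⁻¹
  · subst h; simp [deltaTensor_self]
  · have : k⁻¹ ≠ g := fun h' => h (by rw [← h', inv_inv])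
    simp [deltaTensor_of_ne h, deltaTensor_of_ne this]

theorem commute_of_mem_vonNeumannClosure {H : Type*} [NormedAddCommGroup H] [InnerProductSpace ℂ H]
    [CompleteSpace H] {S : Set (H →L[ℂ] H)} {r x : H →L[ℂ] H} (hx : x ∈ vonNeumannClosure S)
    (h : ∀ a ∈ S, a * r = r * a) (h' : ∀ a ∈ S, star a * r = r * star a) : x * r = r * x := by
  have hc : ((vonNeumannClosure S : VonNeumannAlgebra H) : Set (H →L[ℂ] H)) =
      Set.centralizer (Set.centralizer (S ∪ star S)) :=
    StarSubalgebra.coe_centralizer_centralizer ℂ S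
  rw [← SetLike.mem_coe, hc] at hx
  refine (hx r ?_).symm
  rintro a (ha | ha)
  · exact h a ha
  · simpa using h' _ ha

theorem crossedUnitary_mem_groupVN (s : Γ) : crossedUnitary μ s ∈ groupVN Γ μ :=
  (vonNeumannClosure_le_iff _ _).mp le_rfl ⟨s, rfl⟩

theorem crossedUnitary_mem_crossedProduct (s : Γ) : crossedUnitary μ s ∈ crossedProduct Γ μ :=
  (vonNeumannClosure_le_iff _ _).mp le_rfl (Or.inr ⟨s, rfl⟩)

theorem crossedFunction_mem_crossedProduct (f : Lp ℂ ∞ μ) :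
    crossedFunction Γ μ f ∈ crossedProduct Γ μ :=
  (vonNeumannClosure_le_iff _ _).mp le_rfl (Or.inl ⟨f, rfl⟩)

theorem groupVN_le_crossedProduct : groupVN Γ μ ≤ crossedProduct Γ μ := by
  rw [groupVN, vonNeumannClosure_le_iff]
  rintro _ ⟨s, rfl⟩
  exact crossedUnitary_mem_crossedProduct s

theorem crossedUnitary_crossedVector [IsFiniteMeasure μ] (s : Γ) :
    crossedUnitary μ s (crossedVector Γ μ) = deltaTensor s (Lp.const 2 μ (1 : ℂ)) := by
  rw [crossedVector, crossedUnitary_single, koopman_const, mul_one]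

theorem crossedConj_crossedUnitary_crossedConj (s : Γ) (ξ : EllTwo Γ (Lp ℂ 2 μ)) (g : Γ) :
    crossedConj Γ μ (crossedUnitary μ s (crossedConj Γ μ ξ)) g = ξ (g * s) := by
  rw [crossedConj_apply, crossedUnitary_apply, crossedConj_apply, koopman_koopman,
    ← koopman_conjLTwo, conjLTwo_conjLTwo, koopman_koopman]
  simp [koopman_one]

theorem isModularConjugation_crossedConj [IsFiniteMeasure μ] :
    (crossedProduct Γ μ).IsModularConjugation (crossedConj Γ μ) (crossedVector Γ μ) := by
  -- The test family consists of the products `f u_s`, because `f u_s Ω = δ_s ⊗ f` and these vectors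
  -- are total.
  refine .of_total crossedConj_crossedConj ?_
    (Set.range fun p : Lp ℂ ∞ μ × Γ => crossedFunction Γ μ p.1 * crossedUnitary μ p.2) ?_ ?_ ?_
  · rw [crossedVector, crossedConj_single, conjLTwo_const_one, koopman_const, inv_one]
  · rintro _ ⟨⟨f, s⟩, rfl⟩
    rw [star_mul, star_crossedUnitary, star_crossedFunction, mul_apply_eq_comp,
      mul_apply_eq_comp, crossedUnitary_crossedVector, crossedFunction_single,
      crossedConj_single, crossedVector, crossedFunction_single, crossedUnitary_single,
      conjLTwo_mulLInfty, conjLTwo_const_one, mul_one]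
  · rintro _ ⟨⟨f, s⟩, rfl⟩ x hx ζ
    set a := crossedFunction Γ μ f * crossedUnitary μ s with ha
    set r : EllTwo Γ (Lp ℂ 2 μ) →L[ℂ] EllTwo Γ (Lp ℂ 2 μ) :=
      (crossedConj Γ μ).toContinuousLinearMap.comp
        (a.comp (crossedConj Γ μ).toContinuousLinearMap) with hr
    have hrg : ∀ ξ g, r ξ g = mulLInfty μ (koopmanLInfty μ g (star f)) (ξ (g * s)) :=
      crossedConj_conj_apply f s
    have hu : ∀ t, crossedUnitary μ t * r = r * crossedUnitary μ t := fun t => by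
      ext ξ : 1
      ext1; funext g
      rw [mul_apply_eq_comp, mul_apply_eq_comp, crossedUnitary_apply,
        hrg, hrg, crossedUnitary_apply, koopman_mulLInfty, koopmanLInfty_koopmanLInfty]
      simp [mul_assoc]
    have hf : ∀ f', crossedFunction Γ μ f' * r = r * crossedFunction Γ μ f' := fun f' => by
      ext ξ : 1
      ext1; funext g
      rw [mul_apply_eq_comp, mul_apply_eq_comp, crossedFunction_apply,
        hrg, hrg, crossedFunction_apply, mulLInfty_comm]
    refine congrArg (fun T : EllTwo Γ (Lp ℂ 2 μ) →L[ℂ] EllTwo Γ (Lp ℂ 2 μ) => T ζ)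
      (commute_of_mem_vonNeumannClosure (r := r) hx ?_ ?_).symm
    · rintro _ (⟨f', rfl⟩ | ⟨t, rfl⟩)
      exacts [hf f', hu t]
    · rintro _ (⟨f', rfl⟩ | ⟨t, rfl⟩)
      · simp only [star_crossedFunction, hf]
      · simp only [star_crossedUnitary, hu]
  · intro ζ h
    ext1; funext s
    refine eq_zero_of_forall_inner_mulLInfty fun f => ?_
    have := h _ ⟨(f, s), rfl⟩
    simpa only [mul_apply_eq_comp, crossedUnitary_crossedVector,
      crossedFunction_single, inner_deltaTensor_left] using this

end Koopman
end

noncomputable section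

/-! ### Fourier analysis on the dual of `ℚ²` and on its quotient -/

section Fourier

instance : haarDual.IsHaarMeasure := by unfold haarDual; infer_instance

instance : haarDual.Regular := by unfold haarDual; infer_instance

instance : IsProbabilityMeasure haarDual := ⟨by
  have := Measure.haarMeasure_self (G := DualRatSq) (K₀ := ⊤)
  simpa [haarDual] using this⟩

/-- The character `χ ↦ χ(v)` of the dual of `ℚ²`. -/
def dualChar (v : Fin 2 → ℚ) : C(DualRatSq, ℂ) where
  toFun χ := (χ (RatSq.of v) : ℂ)
  continuous_toFun := by
    refine continuous_subtype_val.comp ?_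
    exact (ContinuousEvalConst.continuous_eval_const (F := C(RatSq, Circle)) (RatSq.of v)).comp
      (ContinuousMonoidHom.isInducing_toContinuousMap RatSq Circle).continuous

theorem dualChar_apply (v : Fin 2 → ℚ) (χ : DualRatSq) : dualChar v χ = χ (RatSq.of v) := rfl

theorem dualChar_add (v w : Fin 2 → ℚ) : dualChar (v + w) = dualChar v * dualChar w := by
  ext χ
  change ((χ (RatSq.of v * RatSq.of w) : Circle) : ℂ) = _
  rw [map_mul]; rfl

theorem dualChar_zero : dualChar 0 = 1 := by
  ext χ
  change ((χ 1 : Circle) : ℂ) = _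
  rw [map_one]; rfl

theorem dualChar_neg_apply (v : Fin 2 → ℚ) (χ : DualRatSq) :
    dualChar (-v) χ = conj (dualChar v χ) := by
  change ((χ (RatSq.of v)⁻¹ : Circle) : ℂ) = conj ((χ (RatSq.of v) : Circle) : ℂ)
  rw [map_inv, Circle.coe_inv_eq_conj]

theorem dualChar_inv (v : Fin 2 → ℚ) (χ : DualRatSq) : dualChar v χ⁻¹ = dualChar (-v) χ := by
  rw [dualChar_neg_apply]
  exact Circle.coe_inv_eq_conj _

/-- The witness is `w ↦ exp(iπ w_i / v_i)` for a coordinate with `v_i ≠ 0`. Translation by it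
changes the sign of `dualChar v`, which forces the integral of `dualChar v` to vanish. -/
theorem exists_dualChar_eq_neg_one {v : Fin 2 → ℚ} (hv : v ≠ 0) :
    ∃ χ : DualRatSq, dualChar v χ = -1 := by
  obtain ⟨i, hi⟩ := Function.ne_iff.mp hv
  have hi' : (v i : ℝ) ≠ 0 := by exact_mod_cast hi
  let χ : RatSq →ₜ* Circle :=
    { toFun := fun w => Circle.exp (Real.pi * ((Multiplicative.toAdd w i : ℚ) : ℝ) / (v i : ℝ))
      map_one' := by
        change Circle.exp (Real.pi * ((0 : ℚ) : ℝ) / (v i : ℝ)) = 1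
        simp
      map_mul' := fun x y => by
        rw [← Circle.exp_add]
        change Circle.exp (Real.pi * ((Multiplicative.toAdd x i + Multiplicative.toAdd y i : ℚ) : ℝ)
          / (v i : ℝ)) = _
        congr 1
        push_cast
        ring
      continuous_toFun := continuous_of_discreteTopology }
  refine ⟨χ, ?_⟩
  change ((Circle.exp (Real.pi * ((v i : ℚ) : ℝ) / (v i : ℝ)) : Circle) : ℂ) = -1
  rw [mul_div_assoc, div_self hi', mul_one, Circle.coe_exp, Complex.exp_pi_mul_I]

/-- The star subalgebra spanned by the characters. -/
def dualCharSubalgebra : StarSubalgebra ℂ C(DualRatSq, ℂ) where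
  toSubalgebra := Algebra.adjoin ℂ (Set.range dualChar)
  star_mem' := by
    change Algebra.adjoin ℂ (Set.range dualChar) ≤ star (Algebra.adjoin ℂ (Set.range dualChar))
    refine Algebra.adjoin_le ?_
    rintro - ⟨v, rfl⟩
    exact Algebra.subset_adjoin ⟨-v, ContinuousMap.ext fun χ => dualChar_neg_apply v χ⟩

/-- Stone-Weierstrass: characters separate points, and since they are closed under products the
algebra they generate is their linear span. -/
theorem span_dualChar_closure_eq_top :
    (Submodule.span ℂ (Set.range dualChar)).topologicalClosure = ⊤ := by
  have hcoe : Subalgebra.toSubmodule dualCharSubalgebra.toSubalgebra =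
      Submodule.span ℂ (Set.range dualChar) := by
    refine Algebra.adjoin_eq_span_of_subset _ (Set.Subset.trans ?_ Submodule.subset_span)
    intro x hx
    refine Submonoid.closure_induction (fun _ => id) ⟨0, dualChar_zero⟩ ?_ hx
    rintro - - - - ⟨v, rfl⟩ ⟨w, rfl⟩
    exact ⟨v + w, dualChar_add v w⟩
  have hsep : dualCharSubalgebra.SeparatesPoints := by
    intro χ ψ hne
    by_contra! hcon
    refine hne (PontryaginDual.ext fun v => Circle.coe_injective ?_)
    exact hcon (dualChar (Multiplicative.toAdd v))
      ⟨dualChar (Multiplicative.toAdd v), Algebra.subset_adjoin ⟨_, rfl⟩, rfl⟩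
  rw [← hcoe]
  exact congrArg (Subalgebra.toSubmodule <| StarSubalgebra.toSubalgebra ·)
    (ContinuousMap.starSubalgebra_topologicalClosure_eq_top_of_separatesPoints _ hsep)

/-- The characters as elements of `L²`. -/
def dualCharLp (v : Fin 2 → ℚ) : Lp ℂ 2 haarDual := ContinuousMap.toLp 2 haarDual ℂ (dualChar v)

theorem coeFn_dualCharLp (v : Fin 2 → ℚ) : dualCharLp v =ᵐ[haarDual] dualChar v :=
  ContinuousMap.coeFn_toLp haarDual (dualChar v)

theorem span_dualCharLp_closure_eq_top :
    (Submodule.span ℂ (Set.range dualCharLp)).topologicalClosure = ⊤ := by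
  convert! (ContinuousMap.toLp_denseRange ℂ haarDual ℂ
    (by norm_num : (2 : ℝ≥0∞) ≠ ∞)).topologicalClosure_map_submodule span_dualChar_closure_eq_top
  rw [Submodule.map_span, ← Set.range_comp]
  rfl

theorem integral_dualChar {v : Fin 2 → ℚ} (hv : v ≠ 0) : ∫ χ, dualChar v χ ∂haarDual = 0 := by
  obtain ⟨χ₀, h⟩ := exists_dualChar_eq_neg_one hv
  refine integral_eq_zero_of_mul_left_eq_neg (g := χ₀) fun χ => ?_
  change ((χ₀ (RatSq.of v) * χ (RatSq.of v) : Circle) : ℂ) = _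
  rw [Circle.coe_mul]
  rw [dualChar_apply] at h
  rw [h, neg_one_mul]; rfl

theorem orthonormal_dualCharLp : Orthonormal ℂ dualCharLp := by
  rw [orthonormal_iff_ite]
  intro v w
  have : ⟪dualCharLp v, dualCharLp w⟫_ℂ = ∫ χ, dualChar (w - v) χ ∂haarDual := by
    rw [L2.inner_def]
    refine integral_congr_ae ?_
    filter_upwards [coeFn_dualCharLp v, coeFn_dualCharLp w] with χ h1 h2
    rw [h1, h2, sub_eq_add_neg, dualChar_add, ContinuousMap.mul_apply, dualChar_neg_apply]
    rfl
  rw [this]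
  split_ifs with h
  · subst h
    simp [dualChar_zero]
  · exact integral_dualChar (sub_ne_zero.mpr (Ne.symm h))

/-- The Hilbert basis of characters. -/
def dualBasis : HilbertBasis (Fin 2 → ℚ) ℂ (Lp ℂ 2 haarDual) :=
  HilbertBasis.mk orthonormal_dualCharLp span_dualCharLp_closure_eq_top.ge

theorem dualBasis_apply (v : Fin 2 → ℚ) : dualBasis v = dualCharLp v :=
  congrFun (HilbertBasis.coe_mk _ _) v

theorem DualQuot.measurePreserving_mk :
    MeasurePreserving DualQuot.mk haarDual DualQuot.measure :=
  ⟨DualQuot.measurable_mk, rfl⟩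

instance : IsProbabilityMeasure DualQuot.measure :=
  Measure.isProbabilityMeasure_map DualQuot.measurable_mk.aemeasurable

theorem DualQuot.mk_inv (χ : DualRatSq) : DualQuot.mk χ⁻¹ = DualQuot.mk χ :=
  Quotient.sound (Or.inr fun v => by
    change χ (RatSq.of v) = ((χ (RatSq.of v)⁻¹ : Circle))⁻¹
    rw [map_inv, inv_inv])

/-- The function `χ ↦ χ(v) + χ(-v)` on the quotient. -/
def cosFun (v : Fin 2 → ℚ) : DualQuot → ℂ :=
  Quotient.lift (fun χ : DualRatSq => dualChar v χ + dualChar (-v) χ) (by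
    rintro χ ψ (h | h)
    · rw [h]
    · have h1 : ∀ w, dualChar w ψ = dualChar (-w) χ := fun w =>
        congrArg (fun z : Circle => (z : ℂ)) (h w)
      change dualChar v χ + dualChar (-v) χ = dualChar v ψ + dualChar (-v) ψ
      rw [h1, h1, neg_neg, add_comm])

theorem cosFun_mk (v : Fin 2 → ℚ) (χ : DualRatSq) :
    cosFun v (DualQuot.mk χ) = dualChar v χ + dualChar (-v) χ := rfl

theorem cosFun_zero (y : DualQuot) : cosFun 0 y = 2 := by
  obtain ⟨χ⟩ := y
  change dualChar 0 χ + dualChar (-0) χ = 2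
  rw [neg_zero, dualChar_zero]; norm_num

theorem cosFun_neg (v : Fin 2 → ℚ) (y : DualQuot) : cosFun (-v) y = cosFun v y := by
  obtain ⟨χ⟩ := y
  change dualChar (-v) χ + dualChar (- -v) χ = dualChar v χ + dualChar (-v) χ
  rw [neg_neg, add_comm]

theorem cosFun_mul (v z : Fin 2 → ℚ) (y : DualQuot) :
    cosFun v y * cosFun z y = cosFun (z + v) y + cosFun (z - v) y := by
  obtain ⟨χ⟩ := y
  change (dualChar v χ + dualChar (-v) χ) * (dualChar z χ + dualChar (-z) χ) =
    dualChar (z + v) χ + dualChar (-(z + v)) χ + (dualChar (z - v) χ + dualChar (-(z - v)) χ)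
  rw [neg_add, neg_sub, sub_eq_add_neg, sub_eq_add_neg]
  simp only [dualChar_add, ContinuousMap.mul_apply]
  ring

theorem conj_cosFun (v : Fin 2 → ℚ) (y : DualQuot) : conj (cosFun v y) = cosFun v y := by
  obtain ⟨χ⟩ := y
  change conj (dualChar v χ + dualChar (-v) χ) = dualChar v χ + dualChar (-v) χ
  rw [map_add, ← dualChar_neg_apply, ← dualChar_neg_apply, neg_neg, add_comm]

theorem cosFun_smul (s : SL(2, ℚ)) (v : Fin 2 → ℚ) (y : DualQuot) :
    cosFun v ((s : PSL(2, ℚ))⁻¹ • y) = cosFun (s.1.mulVec v) y := by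
  obtain ⟨χ⟩ := y
  have h : ∀ w, dualChar w (s⁻¹ • χ) = dualChar (s.1.mulVec w) χ := fun w => by
    rw [dualChar_apply, smul_dualRatSq_apply, inv_inv, dualChar_apply]
  change dualChar v (s⁻¹ • χ) + dualChar (-v) (s⁻¹ • χ) =
    dualChar (s.1.mulVec v) χ + dualChar (-(s.1.mulVec v)) χ
  rw [h, h, Matrix.mulVec_neg]

theorem norm_cosFun_le (v : Fin 2 → ℚ) (y : DualQuot) : ‖cosFun v y‖ ≤ 2 := by
  obtain ⟨χ⟩ := y
  change ‖dualChar v χ + dualChar (-v) χ‖ ≤ 2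
  refine (norm_add_le _ _).trans ?_
  rw [dualChar_apply, dualChar_apply, Circle.norm_coe, Circle.norm_coe]
  norm_num

theorem measurable_cosFun (v : Fin 2 → ℚ) : Measurable (cosFun v) := by
  have h : Measurable fun χ : DualRatSq => dualChar v χ + dualChar (-v) χ :=
    ((dualChar v).continuous.add (dualChar (-v)).continuous).measurable
  exact fun s hs => h hs

/-- The function `χ ↦ χ(v) + χ(-v)` in `L^∞`. -/
def cosLInfty (v : Fin 2 → ℚ) : Lp ℂ ∞ DualQuot.measure :=
  (memLp_top_of_bound (measurable_cosFun v).aestronglyMeasurable 2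
    (Filter.Eventually.of_forall (norm_cosFun_le v))).toLp (cosFun v)

theorem coeFn_cosLInfty (v : Fin 2 → ℚ) : cosLInfty v =ᵐ[DualQuot.measure] cosFun v :=
  MemLp.coeFn_toLp _

/-- The function `χ ↦ χ(v) + χ(-v)` in `L²`. -/
def cosLTwo (v : Fin 2 → ℚ) : Lp ℂ 2 DualQuot.measure :=
  mulLInfty DualQuot.measure (cosLInfty v) (Lp.const 2 DualQuot.measure (1 : ℂ))

theorem coeFn_cosLTwo (v : Fin 2 → ℚ) : cosLTwo v =ᵐ[DualQuot.measure] cosFun v := by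
  filter_upwards [coeFn_mulLInfty (cosLInfty v) (Lp.const 2 DualQuot.measure (1 : ℂ)),
    coeFn_cosLInfty v, Lp.coeFn_const 2 DualQuot.measure (1 : ℂ)] with y h1 h2 h3
  rw [cosLTwo, h1, h2, h3, Function.const_apply, mul_one]

theorem cosLTwo_zero : cosLTwo 0 = (2 : ℂ) • Lp.const 2 DualQuot.measure (1 : ℂ) := by
  apply Lp.ext
  filter_upwards [coeFn_cosLTwo 0, Lp.coeFn_const 2 DualQuot.measure (1 : ℂ),
    Lp.coeFn_smul (2 : ℂ) (Lp.const 2 DualQuot.measure (1 : ℂ))] with y h1 h2 h3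
  rw [h1, h3, Pi.smul_apply, h2, cosFun_zero]
  simp

theorem cosLTwo_neg (v : Fin 2 → ℚ) : cosLTwo (-v) = cosLTwo v := by
  apply Lp.ext
  filter_upwards [coeFn_cosLTwo (-v), coeFn_cosLTwo v] with y h1 h2
  rw [h1, h2, cosFun_neg]

theorem mulLInfty_cosLTwo (v z : Fin 2 → ℚ) :
    mulLInfty DualQuot.measure (cosLInfty v) (cosLTwo z) = cosLTwo (z + v) + cosLTwo (z - v) := by
  apply Lp.ext
  filter_upwards [coeFn_mulLInfty (cosLInfty v) (cosLTwo z), coeFn_cosLInfty v, coeFn_cosLTwo z,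
    coeFn_cosLTwo (z + v), coeFn_cosLTwo (z - v),
    Lp.coeFn_add (cosLTwo (z + v)) (cosLTwo (z - v))] with y h1 h2 h3 h4 h5 h6
  rw [h1, h2, h3, h6, Pi.add_apply, h4, h5, cosFun_mul]

theorem star_cosLInfty (v : Fin 2 → ℚ) : star (cosLInfty v) = cosLInfty v := by
  apply Lp.ext
  filter_upwards [Lp.coeFn_star (cosLInfty v), coeFn_cosLInfty v] with y h1 h2
  rw [h1, Pi.star_apply, h2]
  exact conj_cosFun v y

theorem conjLTwo_cosLTwo (v : Fin 2 → ℚ) :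
    conjLTwo DualQuot.measure (cosLTwo v) = cosLTwo v := by
  apply Lp.ext
  filter_upwards [coeFn_conjLTwo (cosLTwo v), coeFn_cosLTwo v] with y h1 h2
  rw [h1, h2, conj_cosFun]

theorem koopman_cosLTwo (s : SL(2, ℚ)) (v : Fin 2 → ℚ) :
    koopman DualQuot.measure (s : PSL(2, ℚ)) (cosLTwo v) = cosLTwo (s.1.mulVec v) := by
  apply Lp.ext
  filter_upwards [coeFn_koopman (s : PSL(2, ℚ)) (cosLTwo v),
    ae_smul (s : PSL(2, ℚ))⁻¹ (coeFn_cosLTwo v), coeFn_cosLTwo (s.1.mulVec v)] with y h1 h2 h3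
  rw [h1, h2, h3, cosFun_smul]

/-- The inclusion of `L²` of the quotient into `L²` of the dual of `ℚ²`. -/
def liftLTwo : Lp ℂ 2 DualQuot.measure →ₗᵢ[ℂ] Lp ℂ 2 haarDual :=
  Lp.compMeasurePreservingₗᵢ ℂ DualQuot.mk DualQuot.measurePreserving_mk

theorem coeFn_liftLTwo (φ : Lp ℂ 2 DualQuot.measure) :
    liftLTwo φ =ᵐ[haarDual] fun χ => φ (DualQuot.mk χ) :=
  Lp.coeFn_compMeasurePreserving φ DualQuot.measurePreserving_mk

theorem liftLTwo_cosLTwo (v : Fin 2 → ℚ) :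
    liftLTwo (cosLTwo v) = dualCharLp v + dualCharLp (-v) := by
  apply Lp.ext
  filter_upwards [coeFn_liftLTwo (cosLTwo v),
    DualQuot.measurePreserving_mk.quasiMeasurePreserving.ae (coeFn_cosLTwo v),
    coeFn_dualCharLp v, coeFn_dualCharLp (-v), Lp.coeFn_add (dualCharLp v) (dualCharLp (-v))]
    with χ h1 h2 h3 h4 h5
  rw [h1, h2, h5, Pi.add_apply, h3, h4, cosFun_mk]

/-- Functions lifted from the quotient are even and Haar measure is invariant under inversion. -/
theorem inner_dualCharLp_neg (v : Fin 2 → ℚ) (φ : Lp ℂ 2 DualQuot.measure) :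
    ⟪dualCharLp (-v), liftLTwo φ⟫_ℂ = ⟪dualCharLp v, liftLTwo φ⟫_ℂ := by
  have h : ∀ w, ⟪dualCharLp w, liftLTwo φ⟫_ℂ =
      ∫ χ, φ (DualQuot.mk χ) * conj (dualChar w χ) ∂haarDual := fun w => by
    rw [L2.inner_def]
    refine integral_congr_ae ?_
    filter_upwards [coeFn_dualCharLp w, coeFn_liftLTwo φ] with χ h1 h2
    rw [h1, h2]; rfl
  rw [h, h, ← integral_inv_eq_self]
  simp_rw [DualQuot.mk_inv, dualChar_inv, neg_neg]

theorem inner_cosLTwo (v : Fin 2 → ℚ) (φ : Lp ℂ 2 DualQuot.measure) :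
    ⟪cosLTwo v, φ⟫_ℂ = 2 * ⟪dualCharLp v, liftLTwo φ⟫_ℂ := by
  rw [← LinearIsometry.inner_map_map liftLTwo, liftLTwo_cosLTwo, inner_add_left,
    inner_dualCharLp_neg]
  ring

theorem inner_cosLTwo_cosLTwo (v w : Fin 2 → ℚ) :
    ⟪cosLTwo v, cosLTwo w⟫_ℂ = 2 * ((if v = w then 1 else 0) + if v = -w then 1 else 0) := by
  rw [inner_cosLTwo, liftLTwo_cosLTwo, inner_add_right,
    orthonormal_iff_ite.mp orthonormal_dualCharLp, orthonormal_iff_ite.mp orthonormal_dualCharLp]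

/-- Parseval's identity on the quotient. -/
theorem hasSum_inner_cosLTwo (φ ψ : Lp ℂ 2 DualQuot.measure) :
    HasSum (fun z => ⟪φ, cosLTwo z⟫_ℂ * ⟪cosLTwo z, ψ⟫_ℂ) (4 * ⟪φ, ψ⟫_ℂ) := by
  -- The factor 4: each inner product with `cosLTwo z` is twice a Fourier coefficient of the lift.
  have h := (dualBasis.hasSum_inner_mul_inner (liftLTwo φ) (liftLTwo ψ)).mul_left 4
  rw [LinearIsometry.inner_map_map] at h
  refine h.congr_fun ?_
  intro z
  rw [← inner_conj_symm φ, inner_cosLTwo, inner_cosLTwo, dualBasis_apply, map_mul, inner_conj_symm]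
  rw [map_ofNat]
  ring

theorem eq_zero_of_inner_cosLTwo {φ : Lp ℂ 2 DualQuot.measure}
    (h : ∀ z, ⟪cosLTwo z, φ⟫_ℂ = 0) : φ = 0 := by
  have := hasSum_inner_cosLTwo φ φ
  simp_rw [h, mul_zero] at this
  have := this.unique hasSum_zero
  simpa using this

end Fourier

end

noncomputable section

/-! ### Projections onto the orbit closure of an intermediate algebra -/

section OrbitProj

open VonNeumannAlgebra

variable {Γ Y : Type*} [Group Γ] [MeasurableSpace Y] [MulAction Γ Y] [MeasurableConstSMul Γ Y]
  {μ : Measure Y} [SMulInvariantMeasure Γ Y μ] [IsFiniteMeasure μ]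
  {P : VonNeumannAlgebra (EllTwo Γ (Lp ℂ 2 μ))}

/-- The projection of `δ₁ ⊗ φ` onto the closure of the orbit of the tracial vector under `P`. -/
def orbitProj {Γ Y : Type*} [Group Γ] [MeasurableSpace Y] {μ : Measure Y} [IsFiniteMeasure μ]
    (P : VonNeumannAlgebra (EllTwo Γ (Lp ℂ 2 μ))) (φ : Lp ℂ 2 μ) : EllTwo Γ (Lp ℂ 2 μ) :=
  (P.orbitClosure (crossedVector Γ μ)).starProjection (deltaTensor 1 φ)

theorem deltaTensor_const_mem (hN : groupVN Γ μ ≤ P) (g : Γ) :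
    deltaTensor g (Lp.const 2 μ (1 : ℂ)) ∈ P.orbitClosure (crossedVector Γ μ) := by
  rw [← crossedUnitary_crossedVector]
  exact apply_mem_orbitClosure (hN (crossedUnitary_mem_groupVN g))

/-- `δ_g ⊗ φ` arises from `δ₁ ⊗ φ` by the right translation `J u_{g⁻¹} J`, which commutes with the
projection because `u_{g⁻¹} ∈ P`. -/
theorem starProjection_deltaTensor (hN : groupVN Γ μ ≤ P) (hM : P ≤ crossedProduct Γ μ)
    (φ : Lp ℂ 2 μ) (g k : Γ) :
    (P.orbitClosure (crossedVector Γ μ)).starProjection (deltaTensor g φ) k =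
      orbitProj P φ (k * g⁻¹) := by
  have h : deltaTensor g φ =
      crossedConj Γ μ (crossedUnitary μ g⁻¹ (crossedConj Γ μ (deltaTensor 1 φ))) := by
    ext1; funext l
    rw [crossedConj_crossedUnitary_crossedConj]
    by_cases hl : l = g
    · subst hl; rw [mul_inv_cancel, deltaTensor_self, deltaTensor_self]
    · rw [deltaTensor_of_ne hl, deltaTensor_of_ne]
      exact fun h' => hl (mul_inv_eq_one.mp h')
  rw [h, isModularConjugation_crossedConj.starProjection_conj hM
    (hN (crossedUnitary_mem_groupVN g⁻¹)), crossedConj_crossedUnitary_crossedConj]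
  rfl

theorem orbitProj_koopman (hN : groupVN Γ μ ≤ P) (hM : P ≤ crossedProduct Γ μ) (φ : Lp ℂ 2 μ)
    (s g : Γ) : orbitProj P (koopman μ s φ) g = koopman μ s (orbitProj P φ (s⁻¹ * g * s)) := by
  have h : deltaTensor 1 (koopman μ s φ) = crossedUnitary μ s (deltaTensor s⁻¹ φ) := by
    rw [crossedUnitary_single, mul_inv_cancel]
  rw [orbitProj, h, starProjection_orbitClosure_map (hN (crossedUnitary_mem_groupVN s)),
    crossedUnitary_apply, starProjection_deltaTensor hN hM, inv_inv]

theorem crossedConj_orbitProj (hM : P ≤ crossedProduct Γ μ) (φ : Lp ℂ 2 μ) :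
    crossedConj Γ μ (orbitProj P φ) = orbitProj P (conjLTwo μ φ) := by
  rw [orbitProj, ← isModularConjugation_crossedConj.starProjection_map hM, crossedConj_single,
    inv_one, koopman_one, orbitProj]

theorem inner_const_orbitProj (hN : groupVN Γ μ ≤ P) {φ : Lp ℂ 2 μ}
    (hφ : ⟪Lp.const 2 μ (1 : ℂ), φ⟫_ℂ = 0) (g : Γ) :
    ⟪Lp.const 2 μ (1 : ℂ), orbitProj P φ g⟫_ℂ = 0 := by
  rw [← inner_deltaTensor_left, orbitProj, ← Submodule.inner_starProjection_left_eq_right,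
    Submodule.starProjection_eq_self_iff.mpr (deltaTensor_const_mem hN g), inner_deltaTensor_left]
  by_cases hg : g = 1
  · subst hg; rw [deltaTensor_self, hφ]
  · rw [deltaTensor_of_ne hg, inner_zero_right]

/-- The trace identity for `b = f' u_g` in coordinates, with `η` the projection of `δ₁ ⊗ φ`; the
reality of `φ` gives `J η = η`. The freedom in `g` allows a single coefficient to be isolated later.
-/
theorem tsum_inner_orbitProj (hN : groupVN Γ μ ≤ P) (hM : P ≤ crossedProduct Γ μ)
    (f f' : Lp ℂ ∞ μ) (φ : Lp ℂ 2 μ) (hφ : conjLTwo μ φ = φ) (g : Γ) :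
    ∑' k, ⟪orbitProj P (mulLInfty μ f' (Lp.const 2 μ (1 : ℂ))) (k * g⁻¹),
        mulLInfty μ f (orbitProj P φ k)⟫_ℂ =
      ∑' k, ⟪mulLInfty μ f' (koopman μ g (orbitProj P φ (g⁻¹ * k))),
        orbitProj P (mulLInfty μ f (Lp.const 2 μ (1 : ℂ))) k⟫_ℂ := by
  have h := isModularConjugation_crossedConj.inner_starProjection hM
    (mul_mem (crossedFunction_mem_crossedProduct (Γ := Γ) f') (crossedUnitary_mem_crossedProduct g))
    (crossedFunction_mem_crossedProduct f)
    (η := orbitProj P φ) (Submodule.starProjection_apply_mem _ _)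
  rw [mul_apply_eq_comp, mul_apply_eq_comp, crossedUnitary_crossedVector, crossedFunction_single,
    crossedConj_orbitProj hM, hφ, crossedFunction_crossedVector, lp.inner_eq_tsum,
    lp.inner_eq_tsum] at h
  convert h using 1
  · refine tsum_congr fun k => ?_
    rw [starProjection_deltaTensor hN hM, crossedFunction_apply]
  · refine tsum_congr fun k => ?_
    rw [crossedFunction_apply, crossedUnitary_apply]
    rfl

theorem summable_norm_sq_ellTwo {Γ E : Type*} [NormedAddCommGroup E] (ξ : EllTwo Γ E) :
    Summable fun g => ‖ξ g‖ ^ 2 := by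
  have h := (lp.memℓp ξ).summable (by norm_num)
  simpa using h

/-- Along an injective sequence the values of a summable family tend to zero. This finiteness
principle is applied to conjugates of a group element, to orbits of Fourier modes and to geometric
progressions. -/
theorem exists_lt_eq_of_summable {ι : Type*} {f : ι → ℝ} (hf : Summable f) {c : ℝ} (hc : c ≠ 0)
    (u : ℕ → ι) (hu : ∀ n, f (u n) = c) : ∃ m n, m < n ∧ u m = u n := by
  by_contra! h
  have hinj : Function.Injective u := fun m n hmn => by
    rcases lt_trichotomy m n with h' | h' | h'
    · exact absurd hmn (h m n h')
    · exact h'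
    · exact absurd hmn.symm (h n m h')
  have := (hf.comp_injective hinj).tendsto_atTop_zero
  simp only [Function.comp_def, hu] at this
  exact hc (tendsto_nhds_unique tendsto_const_nhds this)

end OrbitProj

/-! ### Matrices -/

section Matrices

theorem coe_eq_coe_iff_PSL {A B : SL(2, ℚ)} :
    (A : PSL(2, ℚ)) = B ↔ A.1 = B.1 ∨ A.1 = -B.1 := by
  have hmul : ∀ C : Matrix (Fin 2) (Fin 2) ℚ, C = (A⁻¹ * B).1 ↔ A.1 * C = B.1 := fun C => by
    constructor
    · rintro rfl
      rw [← Matrix.SpecialLinearGroup.coe_mul, mul_inv_cancel_left]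
    · intro h
      rw [Matrix.SpecialLinearGroup.coe_mul, ← h, ← mul_assoc, ← Matrix.SpecialLinearGroup.coe_mul,
        inv_mul_cancel, Matrix.SpecialLinearGroup.coe_one, one_mul]
  rw [QuotientGroup.eq, Matrix.SpecialLinearGroup.mem_center_iff]
  constructor
  · rintro ⟨r, hr, hg⟩
    have hB := (hmul _).mp hg
    have hr' : r = 1 ∨ r = -1 := sq_eq_one_iff.mp (by simpa using hr)
    rcases hr' with rfl | rfl
    · left; rw [← hB, map_one, mul_one]
    · right; rw [← hB, map_neg, map_one, mul_neg, mul_one, neg_neg]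
  · rintro (h | h)
    · exact ⟨1, by simp, (hmul _).mpr (by rw [map_one, mul_one, h])⟩
    · exact ⟨-1, by simp, (hmul _).mpr (by rw [map_neg, map_one, mul_neg, mul_one, h, neg_neg])⟩

/-- The unipotent matrix `!![1, h; 0, 1]`. -/
def upperUnip (h : ℚ) : SL(2, ℚ) := ⟨!![1, h; 0, 1], by simp⟩

/-- The matrix of the rotation by a right angle. -/
def rotMat : SL(2, ℚ) := ⟨!![0, -1; 1, 0], by simp⟩

theorem upperUnip_mul (a b : ℚ) : upperUnip a * upperUnip b = upperUnip (a + b) := by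
  refine Subtype.ext ?_
  rw [Matrix.SpecialLinearGroup.coe_mul]
  ext i j
  fin_cases i <;> fin_cases j <;> simp [upperUnip, Matrix.mul_apply, add_comm]

theorem upperUnip_zero : upperUnip 0 = 1 := by
  ext i j
  fin_cases i <;> fin_cases j <;> simp [upperUnip]

theorem upperUnip_inv (a : ℚ) : (upperUnip a)⁻¹ = upperUnip (-a) := by
  rw [inv_eq_iff_mul_eq_one, upperUnip_mul, add_neg_cancel, upperUnip_zero]

theorem upperUnip_mulVec (h : ℚ) (z : Fin 2 → ℚ) :
    (upperUnip h).1.mulVec z = ![z 0 + h * z 1, z 1] := by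
  ext i; fin_cases i <;> simp [upperUnip, Matrix.mulVec, dotProduct, Fin.sum_univ_two]

theorem rotMat_mulVec (z : Fin 2 → ℚ) : rotMat.1.mulVec z = ![-z 1, z 0] := by
  ext i; fin_cases i <;> simp [rotMat, Matrix.mulVec, dotProduct, Fin.sum_univ_two]

theorem exists_mulVec_eq {v : Fin 2 → ℚ} (hv : v ≠ 0) :
    ∃ s : SL(2, ℚ), s.1.mulVec ![1, 0] = v := by
  by_cases h0 : v 0 = 0
  · have h1 : v 1 ≠ 0 := fun h1 => hv (by ext i; fin_cases i <;> assumption)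
    refine ⟨⟨!![0, -(v 1)⁻¹; v 1, 0], by simp [h1]⟩, ?_⟩
    ext i; fin_cases i <;> simp [Matrix.mulVec, dotProduct, h0]
  · refine ⟨⟨!![v 0, 0; v 1, (v 0)⁻¹], by simp [h0]⟩, ?_⟩
    ext i; fin_cases i <;> simp [Matrix.mulVec, dotProduct]

/-- An element of `PSL₂(ℚ)` that commutes with a non-trivial upper unipotent is one itself. -/
theorem eq_upperUnip_of_commute {g : PSL(2, ℚ)} {t : ℚ} (ht : t ≠ 0)
    (h : (upperUnip t : PSL(2, ℚ)) * g = g * upperUnip t) : ∃ a, g = upperUnip a := by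
  obtain ⟨A, rfl⟩ := QuotientGroup.mk_surjective g
  have hdet := A.2
  rw [Matrix.det_fin_two] at hdet
  have key := (coe_eq_coe_iff_PSL (A := upperUnip t * A) (B := A * upperUnip t)).mp h
  rw [Matrix.SpecialLinearGroup.coe_mul, Matrix.SpecialLinearGroup.coe_mul] at key
  have hent : ∀ i j, (upperUnip t).1 i j = !![1, t; 0, 1] i j := fun _ _ => rfl
  have hc : A.1 1 0 = 0 ∧ A.1 0 0 = A.1 1 1 := by
    rcases key with key | key
    · have h00 := congrFun (congrFun key 0) 0
      have h01 := congrFun (congrFun key 0) 1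
      simp only [Matrix.mul_apply, Fin.sum_univ_two, hent] at h00 h01
      simp [ht] at h00 h01
      refine ⟨h00, ?_⟩
      have : t * A.1 1 1 = t * A.1 0 0 := by linarith
      exact (mul_left_cancel₀ ht this).symm
    -- In `SL₂` the commutation holds only up to sign. The minus sign would make the first column
    -- zero, against determinant 1.
    · have h10 := congrFun (congrFun key 1) 0
      have h00 := congrFun (congrFun key 0) 0
      simp only [Matrix.mul_apply, Fin.sum_univ_two, hent, Matrix.neg_apply] at h00 h10
      simp at h00 h10
      have hc : A.1 1 0 = 0 := by linarith
      rw [hc] at h00 hdet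
      have ha : A.1 0 0 = 0 := by linarith
      rw [ha] at hdet
      norm_num at hdet
  have hsq : A.1 0 0 = 1 ∨ A.1 0 0 = -1 := by
    rw [← sq_eq_one_iff]
    rw [hc.1, ← hc.2] at hdet
    linarith
  rcases hsq with ha | ha
  · refine ⟨A.1 0 1, congrArg _ ?_⟩
    ext i j
    fin_cases i <;> fin_cases j <;> simp [upperUnip, ha, hc.1, ← hc.2]
  · refine ⟨-A.1 0 1, ?_⟩
    refine coe_eq_coe_iff_PSL.mpr (Or.inr ?_)
    ext i j
    fin_cases i <;> fin_cases j <;> simp [upperUnip, ha, hc.1, ← hc.2]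

end Matrices
end

noncomputable section

/-! ### The projections of the functions `χ ↦ χ(v) + χ(-v)` -/

section CosProj

open VonNeumannAlgebra

theorem inner_cosLTwo_koopman (s : SL(2, ℚ)) (z : Fin 2 → ℚ) (φ : Lp ℂ 2 DualQuot.measure) :
    ⟪cosLTwo (s.1.mulVec z), koopman DualQuot.measure (s : PSL(2, ℚ)) φ⟫_ℂ = ⟪cosLTwo z, φ⟫_ℂ := by
  rw [← koopman_cosLTwo, inner_koopman_left, koopman_koopman, inv_mul_cancel, koopman_one]

theorem inner_cosLTwo_mulLInfty (z y : Fin 2 → ℚ) (φ : Lp ℂ 2 DualQuot.measure) :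
    ⟪cosLTwo y, mulLInfty DualQuot.measure (cosLInfty z) φ⟫_ℂ =
      ⟪cosLTwo (y + z), φ⟫_ℂ + ⟪cosLTwo (y - z), φ⟫_ℂ := by
  rw [← inner_add_left, ← mulLInfty_cosLTwo, inner_mulLInfty_left, star_cosLInfty]

theorem mulVec_inv_mulVec (s : SL(2, ℚ)) (z : Fin 2 → ℚ) :
    s.1.mulVec ((s⁻¹).1.mulVec z) = z := by
  rw [Matrix.mulVec_mulVec, ← Matrix.SpecialLinearGroup.coe_mul, mul_inv_cancel,
    Matrix.SpecialLinearGroup.coe_one, Matrix.one_mulVec]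

theorem inv_mulVec_mulVec (s : SL(2, ℚ)) (z : Fin 2 → ℚ) :
    (s⁻¹).1.mulVec (s.1.mulVec z) = z := by
  simpa using mulVec_inv_mulVec s⁻¹ z

theorem summable_norm_sq_inner_cosLTwo (φ : Lp ℂ 2 DualQuot.measure) :
    Summable fun z => ‖⟪cosLTwo z, φ⟫_ℂ‖ ^ 2 := by
  refine ((hasSum_inner_cosLTwo φ φ).summable.norm).congr fun z => ?_
  rw [norm_mul, norm_inner_symm, sq]

theorem HasSum.eq_add_of_forall_ne {ι : Type*} {f : ι → ℂ} {s : ℂ} (h : HasSum f s) {a b : ι}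
    (hab : a ≠ b) (h0 : ∀ y, y ≠ a → y ≠ b → f y = 0) : s = f a + f b := by
  classical
  refine h.unique ?_
  rw [← Finset.sum_pair hab]
  refine hasSum_sum_of_ne_finset_zero fun y hy => ?_
  simp only [Finset.mem_insert, Finset.mem_singleton, not_or] at hy
  exact h0 y hy.1 hy.2

variable {P : VonNeumannAlgebra (EllTwo PSL(2, ℚ) (Lp ℂ 2 DualQuot.measure))}

theorem orbitProj_cosLTwo_mulVec (hN : groupVN PSL(2, ℚ) DualQuot.measure ≤ P)
    (hM : P ≤ crossedProduct PSL(2, ℚ) DualQuot.measure) (s : SL(2, ℚ))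
    (v : Fin 2 → ℚ) (g : PSL(2, ℚ)) :
    orbitProj P (cosLTwo (s.1.mulVec v)) g =
      koopman DualQuot.measure (s : PSL(2, ℚ))
        (orbitProj P (cosLTwo v) ((s : PSL(2, ℚ))⁻¹ * g * s)) := by
  rw [← koopman_cosLTwo, orbitProj_koopman hN hM]

theorem upperUnip_coe_inv (a : ℚ) : ((upperUnip a : PSL(2, ℚ)))⁻¹ = upperUnip (-a) := by
  rw [← upperUnip_inv]; rfl

theorem upperUnip_coe_mul (a b : ℚ) :
    (upperUnip a : PSL(2, ℚ)) * upperUnip b = upperUnip (a + b) := by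
  rw [← upperUnip_mul]; rfl

theorem upperUnip_mulVec_e (a : ℚ) : (upperUnip a).1.mulVec ![1, 0] = ![1, 0] := by
  rw [upperUnip_mulVec]; simp

/-- Upper unipotents fix `e₁`, so by equivariance the coefficient has the same norm at every
conjugate of `g` by `upperUnip n`. Square summability makes two conjugates coincide, and `g` then
commutes with a non-trivial unipotent. -/
theorem eq_upperUnip_of_orbitProj_ne_zero (hN : groupVN PSL(2, ℚ) DualQuot.measure ≤ P)
    (hM : P ≤ crossedProduct PSL(2, ℚ) DualQuot.measure) {g : PSL(2, ℚ)}
    (hg : orbitProj P (cosLTwo ![1, 0]) g ≠ 0) :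
    ∃ a, g = upperUnip a := by
  obtain ⟨m, n, hmn, h⟩ := exists_lt_eq_of_summable
    (summable_norm_sq_ellTwo (orbitProj P (cosLTwo ![1, 0])))
    (pow_ne_zero 2 (norm_ne_zero_iff.mpr hg))
    (fun n : ℕ => (upperUnip n : PSL(2, ℚ)) * g * (upperUnip n : PSL(2, ℚ))⁻¹) fun n => by
      have := orbitProj_cosLTwo_mulVec hN hM (upperUnip n) ![1, 0]
        ((upperUnip n : PSL(2, ℚ)) * g * (upperUnip n : PSL(2, ℚ))⁻¹)
      rw [upperUnip_mulVec_e] at this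
      rw [this, norm_koopman]
      congr 4
      group
  refine eq_upperUnip_of_commute (t := m - n) (sub_ne_zero.mpr (by exact_mod_cast hmn.ne)) ?_
  have e : (upperUnip (m - n) : PSL(2, ℚ)) = (upperUnip (n : ℚ) : PSL(2, ℚ))⁻¹ * upperUnip m := by
    rw [upperUnip_coe_inv, upperUnip_coe_mul, neg_add_eq_sub]
  rw [mul_inv_eq_iff_eq_mul] at h
  rw [e, mul_assoc, h]
  group

theorem inner_cosLTwo_zero_orbitProj
    (hN : groupVN PSL(2, ℚ) DualQuot.measure ≤ P) {v : Fin 2 → ℚ} (hv : v ≠ 0) (g : PSL(2, ℚ)) :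
    ⟪cosLTwo 0, orbitProj P (cosLTwo v) g⟫_ℂ = 0 := by
  rw [cosLTwo_zero, inner_smul_left, inner_const_orbitProj hN, mul_zero]
  have := inner_cosLTwo_cosLTwo 0 v
  rw [if_neg hv.symm, if_neg (by simpa [eq_comm] using hv), cosLTwo_zero, inner_smul_left] at this
  simpa using this

/-- Upper unipotents fix `e₁` and commute with `upperUnip a`, so this coefficient is invariant under
them and its Fourier coefficients are constant along `z + n z₁ e₁`. That orbit is infinite unless
`z₁ = 0`. The mode `z = 0` is absent since the projection keeps `c_{e₁}` orthogonal to constants. -/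
theorem eq_of_inner_orbitProj_ne_zero (hN : groupVN PSL(2, ℚ) DualQuot.measure ≤ P)
    (hM : P ≤ crossedProduct PSL(2, ℚ) DualQuot.measure) {z : Fin 2 → ℚ} {a : ℚ}
    (hz : ⟪cosLTwo z, orbitProj P (cosLTwo ![1, 0]) (upperUnip a : PSL(2, ℚ))⟫_ℂ ≠ 0) :
    z 1 = 0 ∧ z 0 ≠ 0 := by
  have h1 : z 1 = 0 := by
    obtain ⟨m, n, hmn, h⟩ := exists_lt_eq_of_summable (summable_norm_sq_inner_cosLTwo
      (orbitProj P (cosLTwo ![1, 0]) (upperUnip a : PSL(2, ℚ))))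
      (pow_ne_zero 2 (norm_ne_zero_iff.mpr hz))
      (fun n : ℕ => (upperUnip n).1.mulVec z) fun n => by
        have := orbitProj_cosLTwo_mulVec hN hM (upperUnip n) ![1, 0] (upperUnip a : PSL(2, ℚ))
        rw [upperUnip_mulVec_e, upperUnip_coe_inv, upperUnip_coe_mul, upperUnip_coe_mul,
          neg_add_cancel_comm] at this
        conv_lhs => rw [this, inner_cosLTwo_koopman]
    have h0 := congrFun h 0
    simp only [upperUnip_mulVec, Matrix.cons_val_zero] at h0
    have : ((n : ℚ) - m) * z 1 = 0 := by linarith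
    rcases mul_eq_zero.mp this with h | h
    · exact absurd (by exact_mod_cast (sub_eq_zero.mp h)) hmn.ne'
    · exact h
  refine ⟨h1, fun h0 => hz ?_⟩
  have : z = 0 := by ext i; fin_cases i <;> assumption
  rw [this]
  exact inner_cosLTwo_zero_orbitProj hN (by simp) _

/-- Transport of the case `v = e₁` by transitivity: the stabilizer of `v` is conjugate to the upper
unipotents. -/
theorem exists_mulVec_eq_self (hN : groupVN PSL(2, ℚ) DualQuot.measure ≤ P)
    (hM : P ≤ crossedProduct PSL(2, ℚ) DualQuot.measure) {v : Fin 2 → ℚ} (hv : v ≠ 0)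
    {g : PSL(2, ℚ)} (hg : orbitProj P (cosLTwo v) g ≠ 0) :
    ∃ A : SL(2, ℚ), (A : PSL(2, ℚ)) = g ∧ A.1.mulVec v = v := by
  obtain ⟨s, rfl⟩ := exists_mulVec_eq hv
  rw [orbitProj_cosLTwo_mulVec hN hM] at hg
  obtain ⟨a, ha⟩ := eq_upperUnip_of_orbitProj_ne_zero hN hM fun h => hg (by rw [h, map_zero])
  refine ⟨s * upperUnip a * s⁻¹, ?_, ?_⟩
  · change (s : PSL(2, ℚ)) * (upperUnip a : PSL(2, ℚ)) * (s : PSL(2, ℚ))⁻¹ = g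
    rw [← ha]; group
  · rw [Matrix.SpecialLinearGroup.coe_mul, Matrix.SpecialLinearGroup.coe_mul,
      ← Matrix.mulVec_mulVec, ← Matrix.mulVec_mulVec, inv_mulVec_mulVec, upperUnip_mulVec_e]

theorem rotMat_mulVec_e : rotMat.1.mulVec ![1, 0] = ![0, 1] := by
  rw [rotMat_mulVec]; simp

theorem eq_rotMat_of_orbitProj_ne_zero (hN : groupVN PSL(2, ℚ) DualQuot.measure ≤ P)
    (hM : P ≤ crossedProduct PSL(2, ℚ) DualQuot.measure) {g : PSL(2, ℚ)}
    (hg : orbitProj P (cosLTwo ![0, 1]) g ≠ 0) :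
    ∃ a, g = ((rotMat * upperUnip a * rotMat⁻¹ : SL(2, ℚ)) : PSL(2, ℚ)) := by
  rw [← rotMat_mulVec_e, orbitProj_cosLTwo_mulVec hN hM] at hg
  obtain ⟨a, ha⟩ := eq_upperUnip_of_orbitProj_ne_zero hN hM fun h => hg (by rw [h, map_zero])
  refine ⟨a, ?_⟩
  change g = (rotMat : PSL(2, ℚ)) * (upperUnip a : PSL(2, ℚ)) * (rotMat : PSL(2, ℚ))⁻¹
  rw [← ha]; group

theorem rotMat_conj_mulVec (a : ℚ) (z : Fin 2 → ℚ) :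
    (rotMat * upperUnip a * rotMat⁻¹).1.mulVec z = ![z 0, z 1 - a * z 0] := by
  have h : rotMat⁻¹.1.mulVec z = ![z 1, -z 0] := by
    rw [← inv_mulVec_mulVec rotMat ![z 1, -z 0], rotMat_mulVec]
    congr 1
    ext i; fin_cases i <;> simp
  rw [Matrix.SpecialLinearGroup.coe_mul, Matrix.SpecialLinearGroup.coe_mul,
    ← Matrix.mulVec_mulVec, ← Matrix.mulVec_mulVec, h, upperUnip_mulVec, rotMat_mulVec]
  ext i; fin_cases i <;> simp
  ring

end CosProj
end

noncomputable section

/-! ### Vanishing of the coefficients at non-trivial unipotents. -/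

section Rigidity

open VonNeumannAlgebra

variable {P : VonNeumannAlgebra (EllTwo PSL(2, ℚ) (Lp ℂ 2 DualQuot.measure))}

theorem cosLTwo_cons_neg (p : ℚ) : cosLTwo ![-p, 0] = cosLTwo ![p, 0] := by
  rw [← cosLTwo_neg ![p, 0]]; simp

/-- Opposite unipotent groups meet trivially: compare the first coordinates of the images of `(0,
1)`. -/
theorem upperUnip_eq_rotMat_conj {x y : ℚ}
    (h : (upperUnip x : PSL(2, ℚ)) = ((rotMat * upperUnip y * rotMat⁻¹ : SL(2, ℚ)) : PSL(2, ℚ))) :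
    x = 0 := by
  rcases coe_eq_coe_iff_PSL.mp h with h | h
  · have := congrArg (fun A : Matrix (Fin 2) (Fin 2) ℚ => A.mulVec ![0, 1] 0) h
    simp only [upperUnip_mulVec, rotMat_conj_mulVec] at this
    simpa using this
  · have := congrArg (fun A : Matrix (Fin 2) (Fin 2) ℚ => A.mulVec ![0, 1] 0) h
    simp only [upperUnip_mulVec, rotMat_conj_mulVec, Matrix.neg_mulVec] at this
    simpa using this

/-- The coefficient of `u_g` in the projection vanishes for non-trivial unipotents `g`. -/
theorem orbitProj_upperUnip_eq_zero (hN : groupVN PSL(2, ℚ) DualQuot.measure ≤ P)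
    (hM : P ≤ crossedProduct PSL(2, ℚ) DualQuot.measure) {a : ℚ} (ha : a ≠ 0) :
    orbitProj P (cosLTwo ![1, 0]) (upperUnip a : PSL(2, ℚ)) = 0 := by
  set φ := orbitProj P (cosLTwo ![1, 0]) (upperUnip a : PSL(2, ℚ)) with hφ
  have hsupp : ∀ z : Fin 2 → ℚ, z 1 ≠ 0 → ⟪cosLTwo z, φ⟫_ℂ = 0 := fun z hz => by
    by_contra h
    exact hz (eq_of_inner_orbitProj_ne_zero hN hM h).1
  refine eq_zero_of_inner_cosLTwo fun z₀ => ?_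
  by_contra hz₀
  obtain ⟨hz1, hq⟩ := eq_of_inner_orbitProj_ne_zero hN hM hz₀
  set q := z₀ 0 with hq'
  have hz₀' : z₀ = ![q, 0] := by ext i; fin_cases i <;> simp [hq', hz1]
  -- The sign is needed only to exclude, in `hleft`, that a certain matrix sends `z` to `-z`.
  obtain ⟨ε, hε, hεa⟩ : ∃ ε : ℚ, (ε = 1 ∨ ε = -1) ∧ 2 + ε * a ≠ 0 := by
    by_cases h : a = -2
    · exact ⟨-1, Or.inr rfl, by rw [h]; norm_num⟩
    · exact ⟨1, Or.inl rfl, fun h' => h (by linarith)⟩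
  have hε0 : ε ≠ 0 := by rcases hε with rfl | rfl <;> norm_num
  -- This is `z = (q, 0) + D (ε q, 0)` for the matrix `D` below: multiplication by `c_z` links the
  -- mode `(q, 0)` of `φ` to a mode of `σ_D φ`.
  set z : Fin 2 → ℚ := ![q * (1 + ε * a), ε * q] with hz
  have hz0 : z ≠ 0 := fun h => mul_ne_zero hε0 hq (congrFun h 1)
  set D : SL(2, ℚ) := upperUnip a * rotMat * upperUnip (-a) with hD
  -- `g` is the commutator of `upperUnip a` and `rotMat`. With this choice the term `k = upperUnip
  -- a` on the right of the trace identity is `⟪c_z σ_D φ, φ⟫`.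
  set g : PSL(2, ℚ) := (D : PSL(2, ℚ)) * (rotMat : PSL(2, ℚ))⁻¹ with hg
  have hDcoe : (D : PSL(2, ℚ)) = (upperUnip a : PSL(2, ℚ)) * (rotMat : PSL(2, ℚ)) *
      (upperUnip a : PSL(2, ℚ))⁻¹ := by
    rw [upperUnip_coe_inv]; rfl
  have hconj : ∀ m, ((rotMat * upperUnip m * rotMat⁻¹ : SL(2, ℚ)) : PSL(2, ℚ)) =
    (rotMat : PSL(2, ℚ)) * (upperUnip m : PSL(2, ℚ)) * (rotMat : PSL(2, ℚ))⁻¹ := fun m => rfl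
  have key := tsum_inner_orbitProj hN hM (cosLInfty ![1, 0]) (cosLInfty z) (cosLTwo ![0, 1])
    (conjLTwo_cosLTwo _) g
  change ∑' k, ⟪orbitProj P (cosLTwo z) (k * g⁻¹), mulLInfty _ (cosLInfty ![1, 0])
    (orbitProj P (cosLTwo ![0, 1]) k)⟫_ℂ = ∑' k, ⟪mulLInfty _ (cosLInfty z)
      (koopman DualQuot.measure g (orbitProj P (cosLTwo ![0, 1]) (g⁻¹ * k))),
        orbitProj P (cosLTwo ![1, 0]) k⟫_ℂ at key
  -- A non-zero term would make a product of a lower and an upper unipotent fix `z` up to sign. Its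
  -- first coordinate reads `z₀ - a z₁ = ± z₀`, which contradicts `a ε q ≠ 0` or `2 + ε a ≠ 0`.
  have hleft : ∀ k, ⟪orbitProj P (cosLTwo z) (k * g⁻¹), mulLInfty _ (cosLInfty ![1, 0])
      (orbitProj P (cosLTwo ![0, 1]) k)⟫_ℂ = 0 := fun k => by
    by_cases hk : orbitProj P (cosLTwo ![0, 1]) k = 0
    · rw [hk, map_zero, inner_zero_right]
    by_cases hB : orbitProj P (cosLTwo z) (k * g⁻¹) = 0
    · rw [hB, inner_zero_left]
    exfalso
    obtain ⟨m, rfl⟩ := eq_rotMat_of_orbitProj_ne_zero hN hM hk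
    obtain ⟨B, hBk, hBz⟩ := exists_mulVec_eq_self hN hM hz0 hB
    have hB' : (B : PSL(2, ℚ)) =
        ((rotMat * upperUnip (m + a) * rotMat⁻¹ * upperUnip (-a) : SL(2, ℚ)) : PSL(2, ℚ)) := by
      rw [hBk]
      change _ = (rotMat : PSL(2, ℚ)) * (upperUnip (m + a) : PSL(2, ℚ)) * (rotMat : PSL(2, ℚ))⁻¹ *
        (upperUnip (-a) : PSL(2, ℚ))
      rw [hg, hDcoe, hconj, ← upperUnip_coe_mul, ← upperUnip_coe_inv]
      group
    have hC : ((rotMat * upperUnip (m + a) * rotMat⁻¹ * upperUnip (-a) : SL(2, ℚ))).1.mulVec z 0 =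
        z 0 - a * z 1 := by
      rw [Matrix.SpecialLinearGroup.coe_mul, ← Matrix.mulVec_mulVec, rotMat_conj_mulVec,
        upperUnip_mulVec]
      simp; ring
    have hz00 : z 0 = q * (1 + ε * a) := rfl
    have hz11 : z 1 = ε * q := rfl
    rcases coe_eq_coe_iff_PSL.mp hB' with h | h
    · rw [h] at hBz
      have := congrFun hBz 0
      rw [hC] at this
      have h0 : a * (ε * q) = 0 := by rw [← hz11]; linarith
      simp [ha, hε0, hq] at h0
    · rw [h, Matrix.neg_mulVec] at hBz
      have := congrFun hBz 0
      rw [Pi.neg_apply, hC, hz00, hz11] at this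
      have h0 : q * (2 + ε * a) = 0 := by linarith
      simp [hεa, hq] at h0
  -- A non-zero term at `k = upperUnip b` puts `upperUnip (b - a)` into the opposite unipotent
  -- group, so `b = a`.
  have hright : ∀ k, k ≠ (upperUnip a : PSL(2, ℚ)) → ⟪mulLInfty _ (cosLInfty z)
      (koopman DualQuot.measure g (orbitProj P (cosLTwo ![0, 1]) (g⁻¹ * k))),
        orbitProj P (cosLTwo ![1, 0]) k⟫_ℂ = 0 := fun k hka => by
    by_cases hk : orbitProj P (cosLTwo ![1, 0]) k = 0
    · rw [hk, inner_zero_right]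
    by_cases hB : orbitProj P (cosLTwo ![0, 1]) (g⁻¹ * k) = 0
    · rw [hB, map_zero, map_zero, inner_zero_left]
    exfalso
    obtain ⟨b, rfl⟩ := eq_upperUnip_of_orbitProj_ne_zero hN hM hk
    obtain ⟨m, hm⟩ := eq_rotMat_of_orbitProj_ne_zero hN hM hB
    have : (upperUnip (b - a) : PSL(2, ℚ)) =
        ((rotMat * upperUnip (m - a) * rotMat⁻¹ : SL(2, ℚ)) : PSL(2, ℚ)) := by
      rw [hconj] at hm ⊢
      have e1 : (upperUnip (b - a) : PSL(2, ℚ)) = (upperUnip a : PSL(2, ℚ))⁻¹ * upperUnip b := by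
        rw [upperUnip_coe_inv, upperUnip_coe_mul, neg_add_eq_sub]
      have e2 : (upperUnip (m - a) : PSL(2, ℚ)) = (upperUnip a : PSL(2, ℚ))⁻¹ * upperUnip m := by
        rw [upperUnip_coe_inv, upperUnip_coe_mul, neg_add_eq_sub]
      rw [inv_mul_eq_iff_eq_mul, hg, hDcoe] at hm
      rw [e1, e2, hm]
      group
    exact hka (by rw [sub_eq_zero.mp (upperUnip_eq_rotMat_conj this)])
  rw [tsum_congr hleft, tsum_zero, tsum_eq_single _ hright, ← rotMat_mulVec_e,
    orbitProj_cosLTwo_mulVec hN hM, koopman_koopman] at key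
  have e1 : (rotMat : PSL(2, ℚ))⁻¹ * (g⁻¹ * (upperUnip a : PSL(2, ℚ))) * (rotMat : PSL(2, ℚ)) =
      upperUnip a := by
    rw [hg, hDcoe]; group
  have e2 : g * (rotMat : PSL(2, ℚ)) = (D : PSL(2, ℚ)) := by rw [hg]; group
  rw [e1, e2, ← hφ] at key
  have hDv : ∀ t : ℚ, D.1.mulVec ![t, 0] = ![a * t, t] := fun t => by
    rw [hD, Matrix.SpecialLinearGroup.coe_mul, Matrix.SpecialLinearGroup.coe_mul,
      ← Matrix.mulVec_mulVec, ← Matrix.mulVec_mulVec, upperUnip_mulVec, rotMat_mulVec,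
      upperUnip_mulVec]
    simp
  have hDon : ∀ t : ℚ, ⟪cosLTwo ![a * t, t], koopman DualQuot.measure (D : PSL(2, ℚ)) φ⟫_ℂ =
      ⟪cosLTwo ![t, 0], φ⟫_ℂ := fun t => by
    rw [← hDv, inner_cosLTwo_koopman]
  have hDoff : ∀ w : Fin 2 → ℚ, w 0 ≠ a * w 1 →
      ⟪cosLTwo w, koopman DualQuot.measure (D : PSL(2, ℚ)) φ⟫_ℂ = 0 := fun w hw => by
    rw [← mulVec_inv_mulVec D w, inner_cosLTwo_koopman]
    refine hsupp _ fun h => hw ?_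
    have h2 : (D⁻¹).1.mulVec w = ![(D⁻¹).1.mulVec w 0, 0] := by
      ext i
      fin_cases i
      exacts [rfl, h]
    rw [← mulVec_inv_mulVec D w, h2, hDv]
    simp
  have hcoef := fun y => inner_cosLTwo_mulLInfty z y (koopman DualQuot.measure (D : PSL(2, ℚ)) φ)
  have hsum := hasSum_inner_cosLTwo (mulLInfty _ (cosLInfty z)
    (koopman DualQuot.measure (D : PSL(2, ℚ)) φ)) φ
  rw [← key, mul_zero] at hsum
  have hcq : ∀ t, t = q ∨ t = -q → ⟪cosLTwo ![t, 0], φ⟫_ℂ = ⟪cosLTwo ![q, 0], φ⟫_ℂ := by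
    rintro t (rfl | rfl)
    · rfl
    · rw [cosLTwo_cons_neg]
  have hεq : ε * q = q ∨ ε * q = -q := by rcases hε with rfl | rfl <;> simp
  have hεq' : -(ε * q) = q ∨ -(ε * q) = -q := by rcases hε with rfl | rfl <;> simp
  -- The modes of `φ` lie on `ℚ e₁` and those of `σ_D φ` on the line `w₀ = a w₁`. A shift by `± z`
  -- carries `(t, 0)` to the latter only for `t = ∓ q`. Parseval thus has two terms, each the
  -- squared modulus of the coefficient at `(q, 0)`, with sum zero.
  have hq1 : ⟪cosLTwo ![q, 0], mulLInfty _ (cosLInfty z)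
      (koopman DualQuot.measure (D : PSL(2, ℚ)) φ)⟫_ℂ = ⟪cosLTwo ![q, 0], φ⟫_ℂ := by
    rw [hcoef, hDoff, zero_add, show ![q, 0] - z = ![a * -(ε * q), -(ε * q)] by
      ext i; fin_cases i <;> simp [hz]; ring, hDon, hcq _ hεq']
    simp only [hz, Pi.add_apply, Matrix.cons_val_zero, Matrix.cons_val_one]
    intro h
    exact mul_ne_zero hq two_ne_zero (by linarith)
  have hq2 : ⟪cosLTwo ![-q, 0], mulLInfty _ (cosLInfty z)
      (koopman DualQuot.measure (D : PSL(2, ℚ)) φ)⟫_ℂ = ⟪cosLTwo ![q, 0], φ⟫_ℂ := by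
    rw [hcoef, hDoff (_ - _), add_zero, show ![-q, 0] + z = ![a * (ε * q), ε * q] by
      ext i; fin_cases i <;> simp [hz]; ring, hDon, hcq _ hεq]
    simp only [hz, Pi.sub_apply, Matrix.cons_val_zero, Matrix.cons_val_one]
    intro h
    exact mul_ne_zero hq two_ne_zero (by linarith)
  have hne : (![q, 0] : Fin 2 → ℚ) ≠ ![-q, 0] := fun h => by
    have := congrFun h 0
    simp only [Matrix.cons_val_zero] at this
    exact hq (by linarith)
  have h0 := hsum.eq_add_of_forall_ne hne fun y hy1 hy2 => ?_
  · rw [← inner_conj_symm, hq1, ← inner_conj_symm _ (cosLTwo ![-q, 0]), hq2, cosLTwo_cons_neg,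
      RCLike.conj_mul, ← two_mul] at h0
    have h1 := (mul_eq_zero.mp h0.symm).resolve_left two_ne_zero
    rw [hz₀'] at hz₀
    exact hz₀ (by simpa using h1)
  · by_cases hy : y 1 = 0
    · have hyp : y 0 ≠ q := fun h => hy1 (by ext i; fin_cases i <;> simp [h, hy])
      have hym : y 0 ≠ -q := fun h => hy2 (by ext i; fin_cases i <;> simp [h, hy])
      rw [← inner_conj_symm, hcoef, hDoff, hDoff, add_zero, map_zero, zero_mul]
      · simp only [hz, Pi.sub_apply, Matrix.cons_val_zero, Matrix.cons_val_one, hy]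
        exact fun h => hyp (by linarith)
      · simp only [hz, Pi.add_apply, Matrix.cons_val_zero, Matrix.cons_val_one, hy]
        exact fun h => hym (by linarith)
    · rw [hsupp y hy, mul_zero]

end Rigidity
end

noncomputable section

/-! ### The projection of each `c_v` is zero or `c_v` itself. -/

section Dichotomy

open VonNeumannAlgebra

variable {P : VonNeumannAlgebra (EllTwo PSL(2, ℚ) (Lp ℂ 2 DualQuot.measure))}

theorem orbitProj_apply_eq_zero (hN : groupVN PSL(2, ℚ) DualQuot.measure ≤ P)
    (hM : P ≤ crossedProduct PSL(2, ℚ) DualQuot.measure) {v : Fin 2 → ℚ} (hv : v ≠ 0)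
    {g : PSL(2, ℚ)} (hg : g ≠ 1) : orbitProj P (cosLTwo v) g = 0 := by
  obtain ⟨s, rfl⟩ := exists_mulVec_eq hv
  rw [orbitProj_cosLTwo_mulVec hN hM]
  by_contra h
  obtain ⟨a, ha⟩ := eq_upperUnip_of_orbitProj_ne_zero hN hM fun h' => h (by rw [h', map_zero])
  have ha0 : a ≠ 0 := by
    rintro rfl
    rw [upperUnip_zero] at ha
    refine hg ?_
    calc g = (s : PSL(2, ℚ)) * ((s : PSL(2, ℚ))⁻¹ * g * s) * (s : PSL(2, ℚ))⁻¹ := by group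
      _ = 1 := by
        rw [ha]
        change (s : PSL(2, ℚ)) * (1 : PSL(2, ℚ)) * (s : PSL(2, ℚ))⁻¹ = 1
        rw [mul_one, mul_inv_cancel]
  rw [ha, orbitProj_upperUnip_eq_zero hN hM ha0, map_zero] at h
  exact h rfl

theorem orbitProj_one (hN : groupVN PSL(2, ℚ) DualQuot.measure ≤ P)
    (hM : P ≤ crossedProduct PSL(2, ℚ) DualQuot.measure) (s : SL(2, ℚ)) :
    orbitProj P (cosLTwo (s.1.mulVec ![1, 0])) 1 =
      koopman DualQuot.measure (s : PSL(2, ℚ)) (orbitProj P (cosLTwo ![1, 0]) 1) := by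
  rw [orbitProj_cosLTwo_mulVec hN hM, mul_one, inv_mul_cancel]

/-- The functional equation for the Fourier coefficients of the projection. -/
theorem coeff_functional_equation (hN : groupVN PSL(2, ℚ) DualQuot.measure ≤ P)
    (hM : P ≤ crossedProduct PSL(2, ℚ) DualQuot.measure) {q s : ℚ} (hq : q ≠ 0) (hs : s ≠ 0) :
    conj ⟪cosLTwo ![1 / q, 0], orbitProj P (cosLTwo ![1, 0]) 1⟫_ℂ *
        ⟪cosLTwo ![s / q, 0], orbitProj P (cosLTwo ![1, 0]) 1⟫_ℂ =
      conj ⟪cosLTwo ![s, 0], orbitProj P (cosLTwo ![1, 0]) 1⟫_ℂ *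
        ⟪cosLTwo ![q, 0], orbitProj P (cosLTwo ![1, 0]) 1⟫_ℂ := by
  set φ := orbitProj P (cosLTwo ![1, 0]) 1 with hφ
  have hsupp : ∀ y : Fin 2 → ℚ, y 1 ≠ 0 → ⟪cosLTwo y, φ⟫_ℂ = 0 := fun y hy => by
    by_contra h
    refine hy (eq_of_inner_orbitProj_ne_zero (a := 0) hN hM ?_).1
    rw [upperUnip_zero]
    exact h
  set z : Fin 2 → ℚ := ![q, s] with hz
  have hz0 : z ≠ 0 := fun h => hs (congrFun h 1)
  obtain ⟨A, hA⟩ := exists_mulVec_eq hz0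
  set ψ := koopman DualQuot.measure (A : PSL(2, ℚ)) φ with hψ
  set ω := koopman DualQuot.measure (rotMat : PSL(2, ℚ)) φ with hω
  -- Coefficients away from the identity now vanish, so the trace identity with group element 1 has
  -- one term on each side.
  have key : ⟪ψ, mulLInfty _ (cosLInfty ![1, 0]) ω⟫_ℂ = ⟪mulLInfty _ (cosLInfty z) ω, φ⟫_ℂ := by
    have h := tsum_inner_orbitProj hN hM (cosLInfty ![1, 0]) (cosLInfty z) (cosLTwo ![0, 1])
      (conjLTwo_cosLTwo _) 1
    change ∑' k, ⟪orbitProj P (cosLTwo z) (k * 1⁻¹), mulLInfty _ (cosLInfty ![1, 0])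
      (orbitProj P (cosLTwo ![0, 1]) k)⟫_ℂ = ∑' k, ⟪mulLInfty _ (cosLInfty z)
        (koopman DualQuot.measure 1 (orbitProj P (cosLTwo ![0, 1]) (1⁻¹ * k))),
          orbitProj P (cosLTwo ![1, 0]) k⟫_ℂ at h
    have he : (![1, 0] : Fin 2 → ℚ) ≠ 0 := by simp
    rw [tsum_eq_single 1, tsum_eq_single 1] at h
    · rw [inv_one, mul_one, koopman_one, ← rotMat_mulVec_e, ← hA, orbitProj_one hN hM,
        orbitProj_one hN hM] at h
      rw [hA] at h
      exact h
    · intro k hk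
      rw [orbitProj_apply_eq_zero hN hM he hk, inner_zero_right]
    · intro k hk
      rw [orbitProj_apply_eq_zero hN hM (v := ![0, 1]) (by simp) hk, map_zero, inner_zero_right]
  have hωon : ∀ t : ℚ, ⟪cosLTwo ![0, t], ω⟫_ℂ = ⟪cosLTwo ![t, 0], φ⟫_ℂ := fun t => by
    have : (![0, t] : Fin 2 → ℚ) = rotMat.1.mulVec ![t, 0] := by rw [rotMat_mulVec]; simp
    rw [this, hω, inner_cosLTwo_koopman]
  have hωoff : ∀ w : Fin 2 → ℚ, w 0 ≠ 0 → ⟪cosLTwo w, ω⟫_ℂ = 0 := fun w hw => by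
    have : w = rotMat.1.mulVec ![w 1, -w 0] := by
      rw [rotMat_mulVec]; ext i; fin_cases i <;> simp
    rw [this, hω, inner_cosLTwo_koopman]
    exact hsupp _ (by simpa using hw)
  have hψon : ∀ t : ℚ, ⟪cosLTwo (t • z), ψ⟫_ℂ = ⟪cosLTwo ![t, 0], φ⟫_ℂ := fun t => by
    have : t • z = A.1.mulVec ![t, 0] := by
      rw [← hA, ← Matrix.mulVec_smul]; simp
    rw [this, hψ, inner_cosLTwo_koopman]
  have hψoff : ∀ w : Fin 2 → ℚ, ⟪cosLTwo w, ψ⟫_ℂ ≠ 0 → ∃ t : ℚ, w = t • z := fun w hw => by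
    rw [← mulVec_inv_mulVec A w, hψ, inner_cosLTwo_koopman] at hw
    have h1 : (A⁻¹).1.mulVec w 1 = 0 := by
      by_contra h
      exact hw (hsupp _ h)
    refine ⟨(A⁻¹).1.mulVec w 0, ?_⟩
    rw [← hA, ← Matrix.mulVec_smul]
    conv_lhs => rw [← mulVec_inv_mulVec A w]
    congr 1
    ext i
    fin_cases i
    · simp
    · simpa using h1
  have hsum1 := hasSum_inner_cosLTwo ψ (mulLInfty _ (cosLInfty ![1, 0]) ω)
  have hsum2 := hasSum_inner_cosLTwo (mulLInfty _ (cosLInfty z) ω) φ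
  rw [key] at hsum1
  have hzy : ∀ t : ℚ, t • z = ![t * q, t * s] := fun t => by simp [hz]
  -- The modes of `ψ` lie on `ℚ z` and those of `ω` on `ℚ e₂`. The point `t z ± e₁` lies on `ℚ e₂`
  -- only for `t = ∓ 1/q`; likewise `(y, 0) ± z` does so only for `y = ∓ q`. Both Parseval sums
  -- therefore consist of two equal terms.
  have hne1 : (1 / q) • z ≠ (-(1 / q)) • z := fun h => by
    have := congrFun h 0
    rw [hzy, hzy] at this
    simp [hq] at this
    norm_num at this
  have h1 := hsum1.eq_add_of_forall_ne hne1 fun y hy1 hy2 => ?_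
  swap
  · by_cases hy : ⟪cosLTwo y, ψ⟫_ℂ = 0
    · rw [← inner_conj_symm, hy, map_zero, zero_mul]
    obtain ⟨t, rfl⟩ := hψoff y hy
    rw [inner_cosLTwo_mulLInfty, hωoff, hωoff, add_zero, mul_zero]
    · rw [hzy]
      simp only [Pi.sub_apply, Matrix.cons_val_zero]
      refine fun h => hy1 ?_
      rw [eq_div_of_mul_eq hq (sub_eq_zero.mp h)]
    · rw [hzy]
      simp only [Pi.add_apply, Matrix.cons_val_zero]
      refine fun h => hy2 ?_
      rw [eq_div_of_mul_eq hq (eq_neg_of_add_eq_zero_left h), neg_div]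
  have hne2 : (![q, 0] : Fin 2 → ℚ) ≠ ![-q, 0] := fun h => by
    have := congrFun h 0
    simp only [Matrix.cons_val_zero] at this
    exact hq (by linarith)
  have h2 := hsum2.eq_add_of_forall_ne hne2 fun y hy1 hy2 => ?_
  swap
  · by_cases hy : y 1 = 0
    · rw [← inner_conj_symm, inner_cosLTwo_mulLInfty, hωoff, hωoff, add_zero, map_zero, zero_mul]
      · simp only [hz, Pi.sub_apply, Matrix.cons_val_zero]
        refine fun h => hy1 ?_
        ext i
        fin_cases i
        · simpa using sub_eq_zero.mp h
        · simpa using hy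
      · simp only [hz, Pi.add_apply, Matrix.cons_val_zero]
        refine fun h => hy2 ?_
        ext i
        fin_cases i
        · simpa using eq_neg_of_add_eq_zero_left h
        · simpa using hy
    · rw [hsupp y hy, mul_zero]
  have c1 : ⟪cosLTwo ((1 / q) • z), mulLInfty _ (cosLInfty ![1, 0]) ω⟫_ℂ =
      ⟪cosLTwo ![s / q, 0], φ⟫_ℂ := by
    rw [inner_cosLTwo_mulLInfty, hωoff, zero_add, ← hωon]
    · congr 2
      ext i
      fin_cases i <;> simp [hz, hq]
      ring
    · simp [hz, hq]
  have c2 : ⟪cosLTwo ((-(1 / q)) • z), mulLInfty _ (cosLInfty ![1, 0]) ω⟫_ℂ =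
      ⟪cosLTwo ![s / q, 0], φ⟫_ℂ := by
    rw [inner_cosLTwo_mulLInfty, hωoff (_ - _), add_zero, ← cosLTwo_cons_neg, ← hωon]
    · congr 2
      ext i
      fin_cases i <;> simp [hz, hq]
      ring
    · simp [hz, hq]
      norm_num
  have c3 : ⟪cosLTwo ![q, 0], mulLInfty _ (cosLInfty z) ω⟫_ℂ = ⟪cosLTwo ![s, 0], φ⟫_ℂ := by
    rw [inner_cosLTwo_mulLInfty, hωoff, zero_add, ← cosLTwo_cons_neg, ← hωon]
    · congr 2
      ext i
      fin_cases i <;> simp [hz]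
    · simp [hz, hq]
  have c4 : ⟪cosLTwo ![-q, 0], mulLInfty _ (cosLInfty z) ω⟫_ℂ = ⟪cosLTwo ![s, 0], φ⟫_ℂ := by
    rw [inner_cosLTwo_mulLInfty, hωoff (_ - _), add_zero, ← hωon]
    · congr 2
      ext i
      fin_cases i <;> simp [hz]
    · simp only [hz, Pi.sub_apply, Matrix.cons_val_zero]
      exact fun h => hq (by linarith)
  rw [c1, c2, ← inner_conj_symm ψ (cosLTwo ((1 / q) • z)), hψon, ← inner_conj_symm ψ, hψon,
    cosLTwo_cons_neg] at h1
  rw [← inner_conj_symm _ (cosLTwo ![q, 0]), c3, ← inner_conj_symm _ (cosLTwo ![-q, 0]), c4,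
    cosLTwo_cons_neg] at h2
  have h3 := h1.symm.trans h2
  rw [← two_mul, ← two_mul] at h3
  exact mul_left_cancel₀ two_ne_zero h3

/-- A non-negative function on `ℚ` with the given functional equation that is square summable
along geometric progressions is supported at `±1` and `0`. -/
theorem eq_zero_of_functional_equation {m : ℚ → ℝ} (h0 : ∀ q, 0 ≤ m q)
    (hm : ∀ q s : ℚ, q ≠ 0 → s ≠ 0 → m (1 / q) * m (s / q) = m s * m q)
    (hsum : ∀ (c : ℝ) (q : ℚ), c ≠ 0 → (∀ n : ℕ, m (q ^ n) = c) → ∃ i j : ℕ, i < j ∧ q ^ i = q ^ j)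
    {q : ℚ} (hq : q ≠ 0) (h1 : q ≠ 1) (h2 : q ≠ -1) : m q = 0 := by
  by_contra hx
  have hp : 1 / q ≠ 0 := one_div_ne_zero hq
  -- The pairs `(q, q)` and `(1/q, 1/q)` give `m(q)³ = m(1/q)³`, and non-negativity gives `m(q) =
  -- m(1/q)`. Cancelling `m(q) ≠ 0` in the equation makes `m` invariant under division by `q`, hence
  -- constant and non-zero along the powers of `q⁻¹`.
  have e1 : m (1 / q) * m 1 = m q * m q := by simpa [hq] using hm q q hq hq
  have e2 : m q * m 1 = m (1 / q) * m (1 / q) := by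
    simpa [hq] using hm (1 / q) (1 / q) hp hp
  have hqpos : 0 < m q := lt_of_le_of_ne (h0 q) (Ne.symm hx)
  have e3 : m q = m (1 / q) := by
    have : m q ^ 3 = m (1 / q) ^ 3 := by
      calc m q ^ 3 = m q * (m q * m q) := by ring
        _ = m (1 / q) * (m q * m 1) := by rw [← e1]; ring
        _ = m (1 / q) ^ 3 := by rw [e2]; ring
    exact (pow_left_inj₀ (h0 _) (h0 _) (by norm_num)).mp this
  have e4 : ∀ s : ℚ, s ≠ 0 → m (s / q) = m s := fun s hs => by
    have := hm q s hq hs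
    rw [← e3, mul_comm (m s)] at this
    exact mul_left_cancel₀ hx this
  have e5 : ∀ n : ℕ, m (q⁻¹ ^ n) = m 1 := fun n => by
    induction n with
    | zero => rw [pow_zero]
    | succ n ih => rw [pow_succ, ← div_eq_mul_inv, e4 _ (pow_ne_zero _ (inv_ne_zero hq)), ih]
  have hm1 : m 1 ≠ 0 := fun h => by
    rw [h, mul_zero] at e1
    exact hx (mul_self_eq_zero.mp e1.symm)
  obtain ⟨i, j, hij, h⟩ := hsum _ _ hm1 e5
  have habs : |q⁻¹| ≠ 1 := by
    rw [abs_inv, Ne, inv_eq_one]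
    intro h
    rcases eq_or_eq_neg_of_abs_eq h with h | h
    exacts [h1 h, h2 h]
  have := pow_right_injective₀ (abs_pos.mpr (inv_ne_zero hq)) habs
    (show |q⁻¹| ^ i = |q⁻¹| ^ j by rw [← abs_pow, ← abs_pow, h])
  exact hij.ne this

/-- The projection of the function attached to `v` is zero for all `v ≠ 0`, or it is
that function for all `v ≠ 0`. -/
theorem orbitProj_cosLTwo_dichotomy (hN : groupVN PSL(2, ℚ) DualQuot.measure ≤ P)
    (hM : P ≤ crossedProduct PSL(2, ℚ) DualQuot.measure) :
    (∀ v : Fin 2 → ℚ, v ≠ 0 → orbitProj P (cosLTwo v) = 0) ∨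
      ∀ v : Fin 2 → ℚ, v ≠ 0 → orbitProj P (cosLTwo v) = deltaTensor 1 (cosLTwo v) := by
  have he : (![1, 0] : Fin 2 → ℚ) ≠ 0 := by simp
  set φ := orbitProj P (cosLTwo ![1, 0]) 1 with hφ
  have hcoef : ∀ q : ℚ, q ≠ 1 → q ≠ -1 → ⟪cosLTwo ![q, 0], φ⟫_ℂ = 0 := fun q h1 h2 => by
    by_cases hq : q = 0
    · subst hq
      rw [show (![0, 0] : Fin 2 → ℚ) = 0 by ext i; fin_cases i <;> rfl]
      exact inner_cosLTwo_zero_orbitProj hN he 1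
    refine norm_eq_zero.mp (eq_zero_of_functional_equation
      (m := fun q => ‖⟪cosLTwo ![q, 0], φ⟫_ℂ‖) (fun _ => norm_nonneg _) (fun q s hq hs => ?_)
      (fun c q hc h => ?_) hq h1 h2)
    · have := congrArg norm (coeff_functional_equation hN hM hq hs)
      simpa only [norm_mul, RCLike.norm_conj] using this
    · obtain ⟨i, j, hij, h⟩ := exists_lt_eq_of_summable (summable_norm_sq_inner_cosLTwo φ)
        (pow_ne_zero 2 hc) (fun n : ℕ => ![q ^ n, 0]) fun n => by rw [h n]
      exact ⟨i, j, hij, by simpa using congrFun h 0⟩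
  -- Division by 2 because `c_{e₁}` has squared norm 2.
  set a : ℂ := ⟪cosLTwo ![1, 0], φ⟫_ℂ / 2 with ha
  have hφa : φ = a • cosLTwo ![1, 0] := by
    rw [← sub_eq_zero]
    have hself : ⟪cosLTwo ![1, 0], cosLTwo ![1, 0]⟫_ℂ = 2 := by
      rw [inner_cosLTwo_cosLTwo, if_pos rfl, if_neg, add_zero, mul_one]
      intro h
      have := congrFun h 0
      norm_num at this
    have h1 : ⟪cosLTwo ![1, 0], φ - a • cosLTwo ![1, 0]⟫_ℂ = 0 := by
      rw [inner_sub_right, inner_smul_right, hself, ha]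
      ring
    refine eq_zero_of_inner_cosLTwo fun z => ?_
    by_cases hz1 : z = ![1, 0]
    · rw [hz1, h1]
    by_cases hz2 : z = -![1, 0]
    · rw [hz2, cosLTwo_neg, h1]
    rw [inner_sub_right, inner_smul_right, inner_cosLTwo_cosLTwo, if_neg hz1, if_neg hz2, add_zero,
      mul_zero, mul_zero, sub_zero]
    by_cases h : z 1 = 0
    · have hz : z = ![z 0, 0] := by ext i; fin_cases i <;> simp [h]
      rw [hz] at hz1 hz2 ⊢
      refine hcoef _ (fun h => hz1 (by rw [h])) fun h => hz2 ?_
      rw [h]; simp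
    · by_contra h'
      refine h (eq_of_inner_orbitProj_ne_zero (a := 0) hN hM ?_).1
      rw [upperUnip_zero]
      exact h'
  have hproj : orbitProj P (cosLTwo ![1, 0]) = a • deltaTensor 1 (cosLTwo ![1, 0]) := by
    ext1; funext g
    change _ = a • deltaTensor 1 (cosLTwo ![1, 0]) g
    by_cases hg : g = 1
    · rw [hg, deltaTensor_self, ← hφa]
    · rw [orbitProj_apply_eq_zero hN hM he hg, deltaTensor_of_ne hg, smul_zero]
  -- The projection fixes its own value, while linearity multiplies that value by `a`.
  have hidem : (1 - a) • orbitProj P (cosLTwo ![1, 0]) = 0 := by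
    have h1 : (P.orbitClosure (crossedVector PSL(2, ℚ) DualQuot.measure)).starProjection
        (orbitProj P (cosLTwo ![1, 0])) = orbitProj P (cosLTwo ![1, 0]) :=
      Submodule.starProjection_eq_self_iff.mpr (Submodule.starProjection_apply_mem _ _)
    conv_lhs at h1 => rw [hproj, map_smul]
    rw [sub_smul, one_smul, sub_eq_zero]
    exact h1.symm
  rcases smul_eq_zero.mp hidem with h | h
  · right
    intro v hv
    obtain ⟨s, rfl⟩ := exists_mulVec_eq hv
    rw [← sub_eq_zero.mp h, one_smul] at hproj
    ext1; funext g
    by_cases hg : g = 1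
    · rw [hg, orbitProj_one hN hM, hproj, deltaTensor_self, deltaTensor_self, koopman_cosLTwo]
    · rw [orbitProj_apply_eq_zero hN hM hv hg, deltaTensor_of_ne hg]
  · left
    intro v hv
    obtain ⟨s, rfl⟩ := exists_mulVec_eq hv
    ext1; funext g
    rw [orbitProj_cosLTwo_mulVec hN hM, h]
    exact map_zero _

end Dichotomy

/-! ### From the dichotomy to the two possible algebras. -/

section Maximality

open VonNeumannAlgebra

variable {P : VonNeumannAlgebra (EllTwo PSL(2, ℚ) (Lp ℂ 2 DualQuot.measure))}

theorem mem_of_forall_orthogonal {H : Type*} [NormedAddCommGroup H] [InnerProductSpace ℂ H]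
    (K : Submodule ℂ H) [K.HasOrthogonalProjection] {x : H}
    (h : ∀ η ∈ Kᗮ, ⟪η, x⟫_ℂ = 0) : x ∈ K := by
  rw [← K.orthogonal_orthogonal]
  exact (Submodule.mem_orthogonal _ _).mpr h

/-- A vector orthogonal to `P Ω` has a coordinate at 1 orthogonal to every `c_z`, including the
constant `c_0`, so that coordinate is zero. Hence `f Ω = δ₁ ⊗ f` lies in the closure of `P Ω`, and
`f ∈ P`. -/
theorem eq_crossedProduct (hN : groupVN PSL(2, ℚ) DualQuot.measure ≤ P)
    (hM : P ≤ crossedProduct PSL(2, ℚ) DualQuot.measure)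
    (h : ∀ v : Fin 2 → ℚ, v ≠ 0 → orbitProj P (cosLTwo v) = deltaTensor 1 (cosLTwo v)) :
    P = crossedProduct PSL(2, ℚ) DualQuot.measure := by
  refine le_antisymm hM ((vonNeumannClosure_le_iff _ _).mpr ?_)
  rintro _ (⟨f, rfl⟩ | ⟨s, rfl⟩)
  · refine isModularConjugation_crossedConj.mem_of_apply_mem hM
      (crossedFunction_mem_crossedProduct f) ?_
    rw [crossedFunction_crossedVector]
    refine mem_of_forall_orthogonal _ fun η hη => ?_
    have hη1 : η 1 = 0 := eq_zero_of_inner_cosLTwo fun z => by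
      rw [← inner_deltaTensor_left]
      refine hη _ ?_
      by_cases hz : z = 0
      · have : deltaTensor (1 : PSL(2, ℚ)) (cosLTwo z) = (2 : ℂ) • deltaTensor (1 : PSL(2, ℚ))
            (Lp.const 2 DualQuot.measure (1 : ℂ)) := by
          ext1; funext g
          change _ = (2 : ℂ) • deltaTensor (1 : PSL(2, ℚ)) (Lp.const 2 DualQuot.measure (1 : ℂ)) g
          by_cases hg : g = 1
          · rw [hg, deltaTensor_self, deltaTensor_self, hz, cosLTwo_zero]
          · rw [deltaTensor_of_ne hg, deltaTensor_of_ne hg, smul_zero]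
        rw [this]
        exact Submodule.smul_mem _ _ (deltaTensor_const_mem hN 1)
      · rw [← h z hz]
        exact Submodule.starProjection_apply_mem _ _
    rw [inner_deltaTensor_right, hη1, inner_zero_left]
  · exact hN (crossedUnitary_mem_groupVN s)

/-- For `x ∈ P` the vector `x Ω` is fixed by the projection, which kills every `δ_g ⊗ c_z` with `z ≠
0`. Only constant modes remain, and these lie in the closure of `L(PSL₂(ℚ)) Ω`. -/
theorem eq_groupVN (hN : groupVN PSL(2, ℚ) DualQuot.measure ≤ P)
    (hM : P ≤ crossedProduct PSL(2, ℚ) DualQuot.measure)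
    (h : ∀ v : Fin 2 → ℚ, v ≠ 0 → orbitProj P (cosLTwo v) = 0) :
    P = groupVN PSL(2, ℚ) DualQuot.measure := by
  refine le_antisymm (fun x hx => ?_) hN
  refine isModularConjugation_crossedConj.mem_of_apply_mem groupVN_le_crossedProduct (hM hx) ?_
  refine mem_of_forall_orthogonal _ fun η hη => ?_
  have hzero : ∀ g, ⟪η g, x (crossedVector PSL(2, ℚ) DualQuot.measure) g⟫_ℂ = 0 := fun g => by
    have hsum := hasSum_inner_cosLTwo (η g) (x (crossedVector PSL(2, ℚ) DualQuot.measure) g)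
    have hterm : ∀ z, ⟪η g, cosLTwo z⟫_ℂ *
        ⟪cosLTwo z, x (crossedVector PSL(2, ℚ) DualQuot.measure) g⟫_ℂ = 0 := fun z => by
      by_cases hz : z = 0
      · have := hη _ (deltaTensor_const_mem le_rfl g)
        rw [inner_deltaTensor_left, ← inner_conj_symm, map_eq_zero] at this
        rw [hz, cosLTwo_zero, inner_smul_right, this, mul_zero, zero_mul]
      · have hpr : (P.orbitClosure (crossedVector PSL(2, ℚ) DualQuot.measure)).starProjection
            (deltaTensor g (cosLTwo z)) = 0 := by
          ext1; funext k
          rw [starProjection_deltaTensor hN hM, h z hz]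
          rfl
        rw [← inner_deltaTensor_left,
          ← Submodule.starProjection_eq_self_iff.mpr (apply_mem_orbitClosure hx),
          ← Submodule.inner_starProjection_left_eq_right, hpr, inner_zero_left, mul_zero]
    simp_rw [hterm] at hsum
    simpa using hsum.unique hasSum_zero
  rw [lp.inner_eq_tsum, tsum_congr hzero, tsum_zero]

/-- The operator `T ⊗ 1`, with `T` the projection of `L²(Y)` onto constants, commutes with all
`u_s`. If it commuted with `c_{e₁}` too, evaluation at `Ω` would give `c_{e₁} = T c_{e₁} = 0`. -/
theorem crossedFunction_cosLInfty_notMem_groupVN :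
    crossedFunction PSL(2, ℚ) DualQuot.measure (cosLInfty ![1, 0]) ∉
      groupVN PSL(2, ℚ) DualQuot.measure := by
  intro hmem
  set c : Lp ℂ 2 DualQuot.measure := Lp.const 2 DualQuot.measure (1 : ℂ) with hc
  set T : Lp ℂ 2 DualQuot.measure →L[ℂ] Lp ℂ 2 DualQuot.measure :=
    (innerSL ℂ c).smulRight c with hT
  have hTapp : ∀ φ, T φ = ⟪c, φ⟫_ℂ • c := fun φ => rfl
  set r := tensorShift T (1 : PSL(2, ℚ)) with hr
  have hrapp : ∀ ξ g, r ξ g = T (ξ g) := fun ξ g => by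
    rw [hr, tensorShift_apply, inv_one, one_mul]
  have hu : ∀ s : PSL(2, ℚ), crossedUnitary DualQuot.measure s * r =
      r * crossedUnitary DualQuot.measure s := fun s => by
    ext ξ : 1
    ext1; funext g
    rw [mul_apply_eq_comp, mul_apply_eq_comp, crossedUnitary_apply, hrapp, hrapp,
      crossedUnitary_apply, hTapp, hTapp, map_smul, koopman_const]
    congr 1
    conv_rhs => rw [hc, ← koopman_const s, inner_koopman_left, koopman_koopman, inv_mul_cancel,
      koopman_one]
  have hcomm := commute_of_mem_vonNeumannClosure (r := r) hmem
    (by rintro _ ⟨s, rfl⟩; exact hu s)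
    (by rintro _ ⟨s, rfl⟩; simp only [star_crossedUnitary, hu])
  have h := congrArg (fun A : EllTwo PSL(2, ℚ) (Lp ℂ 2 DualQuot.measure) →L[ℂ]
    EllTwo PSL(2, ℚ) (Lp ℂ 2 DualQuot.measure) =>
      A (crossedVector PSL(2, ℚ) DualQuot.measure) 1) hcomm
  simp only [mul_apply_eq_comp, hrapp, crossedFunction_apply, crossedVector, deltaTensor_self,
    hTapp] at h
  have hcos : mulLInfty DualQuot.measure (cosLInfty ![1, 0]) c = cosLTwo ![1, 0] := rfl
  have hc0 : ∀ φ, ⟪cosLTwo 0, φ⟫_ℂ = 2 * ⟪c, φ⟫_ℂ := fun φ => by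
    rw [cosLTwo_zero, inner_smul_left, map_ofNat]
  have hcc : ⟪c, c⟫_ℂ = 1 := by
    have := inner_cosLTwo_cosLTwo 0 0
    rw [hc0, cosLTwo_zero, inner_smul_right] at this
    norm_num at this
    linear_combination this / 4
  have hce : ⟪c, cosLTwo ![1, 0]⟫_ℂ = 0 := by
    have := inner_cosLTwo_cosLTwo 0 ![1, 0]
    rw [hc0, if_neg (by simp [eq_comm]), if_neg fun h0 => by simpa using congrFun h0 0] at this
    simpa using this
  rw [← hc, hcc, one_smul, hcos, hce, zero_smul] at h
  have hself := inner_cosLTwo_cosLTwo ![1, 0] ![1, 0]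
  rw [h, inner_zero_left, if_pos rfl] at hself
  split_ifs at hself <;> norm_num at hself

end Maximality
end

theorem mainTheorem5 :
    groupVN PSL(2, ℚ) DualQuot.measure < crossedProduct PSL(2, ℚ) DualQuot.measure ∧
    ∀ P : VonNeumannAlgebra (EllTwo PSL(2, ℚ) (Lp ℂ 2 DualQuot.measure)),
      groupVN PSL(2, ℚ) DualQuot.measure ≤ P →
      P ≤ crossedProduct PSL(2, ℚ) DualQuot.measure →
      P = groupVN PSL(2, ℚ) DualQuot.measure ∨
        P = crossedProduct PSL(2, ℚ) DualQuot.measure := by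
  refine ⟨lt_of_le_of_ne groupVN_le_crossedProduct fun h => ?_, fun P hN hM => ?_⟩
  · refine crossedFunction_cosLInfty_notMem_groupVN ?_
    rw [h]
    exact crossedFunction_mem_crossedProduct _
  · rcases orbitProj_cosLTwo_dichotomy hN hM with h | h
    · exact Or.inl (eq_groupVN hN hM h)
    · exact Or.inr (eq_crossedProduct hN hM h)
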